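/- Let $N\ge 1$ and $d_1,\dots,d_N$ be integers, let $h^{(j)}:\mathbb{R}^{d_1}\times\cdots\times\mathbb{R}^{d_N}\to\mathbb{R}^{d_j}$, and let the random sequences $x^{(j)}_n\in\mathbb{R}^{d_j}$ on a probability space satisfy, for $1\le j\le N$ and $n\ge 0$, $$x^{(j)}_{n+1}=x^{(j)}_n+\alpha^{(j)}_n\bigl(h^{(j)}(x^{(1)}_n,\dots,x^{(N)}_n)+M^{(j)}_{n+1}\bigr).$$ Assume: (A:1) every $h^{(j)}$ is Lipschitz continuous. (A:2) For each $j$, $\{M^{(j)}_{n+1}\}_{n\ge0}$ is a martingale difference sequence with respect to $\mathcal{F}_n=\sigma(x^{(k)}_i,\,0\le i\le n;\ M^{(k)}_i,\,1\le i\le n;\ 1\le k\le N)$, that is, $M^{(j)}_{n+1}$ is integrable with $\mathbb{E}[M^{(j)}_{n+1}\mid\mathcal{F}_n]=0$ a.s., and for constants $K^{(j)}>0$, $\mathbb{E}[\|M^{(j)}_{n+1}\|^2\mid\mathcal{F}_n]\le K^{(j)}\bigl(1+\sum_{k=1}^N\|x^{(k)}_n\|^2\bigr)$ a.s. for all $n\ge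 0$. (A:3) The step sizes are deterministic with $\alpha^{(j)}_n>0$, $\sum_n\alpha^{(j)}_n=\infty$ for all $j$, $\sum_n\sum_{j=1}^N(\alpha^{(j)}_n)^2<\infty$, and $\alpha^{(j)}_n/\alpha^{(j-1)}_n\to0$ as $n\to\infty$ for $1<j\le N$. An equilibrium $e$ of an ODE $\dot x=f(x)$ is called globally asymptotically stable if solutions on $[0,\infty)$ exist for all initial values, $e$ is Lyapunov stable, and every solution on $[0,\infty)$ converges to $e$. Such an $e$ is the only equilibrium. Given maps $\lambda^{(j)}:\mathbb{R}^{d_{j+1}}\times\cdots\times\mathbb{R}^{d_N}\to\mathbb{R}^{d_j}$ (for $j=N$: a point of $\mathbb{R}^{d_N}$), an index $i$, and $(x^{(i)},\dots,x^{(N)})$, let $Y^{(i)}_\lambda(x^{(i)},\dots,x^{(N)})=(y^{(1)},\dots,y^{(N)})$, where $y^{(j)}=x^{(j)}$ for $j\ge i$ and, recursively for $j=i-1,i-2,\dots,1$, $y^{(j)}=\lambda^{(j)}(y^{(j+1)},\dots,y^{(N)})$. (B.N.i), $1\le i\le N$: there are functions $h^{(i)}_\infty$ and Lipschitz maps $\lambda^{(i)}_\infty:\mathbb{R}^{d_{i+1}}\times\cdots\times\mathbb{R}^{d_N}\to\mathbb{R}^{d_i}$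 with $\lambda^{(i)}_\infty(0,\dots,0)=0$ (for $i=N$ this means $\lambda^{(N)}_\infty=0\in\mathbb{R}^{d_N}$) such that, as $c\to\infty$, the functions $$h^{(i)}_c(x^{(i)},\dots,x^{(N)})=\frac1c\,h^{(i)}\bigl(c\,Y^{(i)}_{\lambda_\infty}(x^{(i)},\dots,x^{(N)})\bigr),\qquad c\ge1,$$ converge to $h^{(i)}_\infty$ uniformly on compact sets, and, for all fixed $x^{(i+1)},\dots,x^{(N)}$, the ODE $\dot x^{(i)}(t)=h^{(i)}_\infty(x^{(i)}(t),x^{(i+1)},\dots,x^{(N)})$ has $\lambda^{(i)}_\infty(x^{(i+1)},\dots,x^{(N)})$ as its unique globally asymptotically stable equilibrium. (C.N.i), $1\le i\le N$: there are maps $\lambda^{(i)}:\mathbb{R}^{d_{i+1}}\times\cdots\times\mathbb{R}^{d_N}\to\mathbb{R}^{d_i}$ (for $i=N$: a point $x^{(N)}_*\in\mathbb{R}^{d_N}$) such that, for all fixed $x^{(i+1)},\dots,x^{(N)}$, the ODE $\dot x^{(i)}(t)=h^{(i)}\bigl(Y^{(i)}_{\lambda}(x^{(i)}(t),x^{(i+1)},\dots,x^{(N)})\bigr)$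 has $\lambda^{(i)}(x^{(i+1)},\dots,x^{(N)})$ as a globally asymptotically stable equilibrium. Then, almost surely, $$\sup_{n\ge0}\Bigl(\|x^{(1)}_n\|+\|x^{(2)}_n\|+\cdots+\|x^{(N)}_n\|\Bigr)<\infty.$$ -/

import Mathlib

open MeasureTheory Filter Topology
open scoped NNReal ENNReal

section NTimescale

/-- Tuples `(x⁽¹⁾, …, x⁽ᴺ⁾)` with `x⁽ʲ⁾ ∈ ℝ^{d j}`, indexed by `Fin N`. -/
abbrev NState {N : ℕ} (d : Fin N → ℕ) : Type :=
  (j : Fin N) → EuclideanSpace ℝ (Fin (d j))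

/-- Tuples `(x⁽ⁱ⁾, x⁽ⁱ⁺¹⁾, …, x⁽ᴺ⁾)`. -/
abbrev NFrom {N : ℕ} (d : Fin N → ℕ) (i : Fin N) : Type :=
  (j : {j : Fin N // i ≤ j}) → EuclideanSpace ℝ (Fin (d j.1))

/-- Tuples `(x⁽ⁱ⁺¹⁾, …, x⁽ᴺ⁾)`; for the last index this is a one-point space, and a function
on it is just a point. -/
abbrev NAbove {N : ℕ} (d : Fin N → ℕ) (i : Fin N) : Type :=
  (j : {j : Fin N // i < j}) → EuclideanSpace ℝ (Fin (d j.1))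

/-- The tuple `(u, p⁽ⁱ⁺¹⁾, …, p⁽ᴺ⁾)`. -/
def NFrom.cons {N : ℕ} {d : Fin N → ℕ} (i : Fin N) (u : EuclideanSpace ℝ (Fin (d i)))
    (p : NAbove d i) : NFrom d i :=
  fun j => if h : i = j.1 then h ▸ u else p ⟨j.1, lt_of_le_of_ne j.2 h⟩

theorem NFrom.cons_self {N : ℕ} {d : Fin N → ℕ} (i : Fin N)
    (u : EuclideanSpace ℝ (Fin (d i))) (p : NAbove d i) :
    NFrom.cons i u p ⟨i, le_refl i⟩ = u := by
  simp [NFrom.cons]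

theorem NFrom.cons_of_lt {N : ℕ} {d : Fin N → ℕ} (i : Fin N)
    (u : EuclideanSpace ℝ (Fin (d i))) (p : NAbove d i) (j : Fin N) (h : i < j) :
    NFrom.cons i u p ⟨j, h.le⟩ = p ⟨j, h⟩ := by
  simp [NFrom.cons, h.ne]

/-- The full tuple obtained from `y = (y⁽ⁱ⁾, …, y⁽ᴺ⁾)` by filling in the indices `j < i`
downwards: `y⁽ʲ⁾ = lam⁽ʲ⁾ (y⁽ʲ⁺¹⁾, …, y⁽ᴺ⁾)` for `j = i - 1, i - 2, …, 1`. -/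
noncomputable def cascade {N : ℕ} {d : Fin N → ℕ}
    (lam : (i : Fin N) → NAbove d i → EuclideanSpace ℝ (Fin (d i)))
    (i : Fin N) (y : NFrom d i) (j : Fin N) : EuclideanSpace ℝ (Fin (d j)) :=
  if h : i ≤ j then y ⟨j, h⟩ else lam j (fun k => cascade lam i y k.1)
termination_by N - j.1
decreasing_by
  have _h1 : j.1 < k.1.1 := k.2
  have _h2 := k.1.2
  omega

/-- The scaled function
`h_c⁽ⁱ⁾ (x⁽ⁱ⁾, …, x⁽ᴺ⁾) = h⁽ⁱ⁾ (c y⁽¹⁾, …, c y⁽ᴺ⁾) / c`, where `y⁽ʲ⁾ = x⁽ʲ⁾` for `j ≥ i` and the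
`y⁽ʲ⁾` with `j < i` are filled in through `lamInf`. -/
noncomputable def scaledDrift {N : ℕ} {d : Fin N → ℕ}
    (h : (j : Fin N) → NState d → EuclideanSpace ℝ (Fin (d j)))
    (lamInf : (i : Fin N) → NAbove d i → EuclideanSpace ℝ (Fin (d i)))
    (i : Fin N) (c : ℝ) (y : NFrom d i) : EuclideanSpace ℝ (Fin (d i)) :=
  c⁻¹ • h i (fun j => c • cascade lamInf i y j)

/-- `e` is a globally asymptotically stable equilibrium of the autonomous ODE `ẋ = f x`:
it is an equilibrium, every initial condition has a solution on `[0, ∞)`, `e` is Lyapunov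
stable, and all solutions converge to `e`. (Solutions exist automatically if `f` is Lipschitz.) -/
structure IsGASEquilibrium {E : Type*} [NormedAddCommGroup E] [NormedSpace ℝ E]
    (f : E → E) (e : E) : Prop where
  equilibrium : f e = 0
  exists_solution : ∀ x₀ : E, ∃ x : ℝ → E, x 0 = x₀ ∧
    IsIntegralCurveOn x (fun _ => f) (Set.Ici 0)
  stable : ∀ ε > 0, ∃ δ > 0, ∀ x : ℝ → E, IsIntegralCurveOn x (fun _ => f) (Set.Ici 0) →
    ‖x 0 - e‖ < δ → ∀ t ≥ 0, ‖x t - e‖ < ε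
  attractive : ∀ x : ℝ → E, IsIntegralCurveOn x (fun _ => f) (Set.Ici 0) →
    Tendsto x atTop (𝓝 e)

/-- A globally asymptotically stable equilibrium is the only equilibrium. -/
theorem IsGASEquilibrium.eq_of_equilibrium {E : Type*} [NormedAddCommGroup E]
    [NormedSpace ℝ E] {f : E → E} {e e' : E} (he : IsGASEquilibrium f e) (h0 : f e' = 0) :
    e' = e := by
  have h := he.attractive (fun _ => e') (fun t _ => by
    simpa [h0] using hasDerivWithinAt_const t (Set.Ici (0 : ℝ)) e')
  exact tendsto_nhds_unique tendsto_const_nhds h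

/-- The sigma-field `ℱ_n = σ(x⁽ʲ⁾_i, M⁽ʲ⁾_i : i ≤ n, 1 ≤ j ≤ N)`. The noise starts at time
`1`; the value `M 0` plays no role. -/
def history {N : ℕ} {d : Fin N → ℕ} {Ω : Type*} (x M : ℕ → Ω → NState d) (n : ℕ) :
    MeasurableSpace Ω :=
  (⨆ i : ℕ, ⨆ (_ : i ≤ n), ⨆ j : Fin N,
      MeasurableSpace.comap (fun ω => x i ω j) inferInstance) ⊔
    ⨆ i : ℕ, ⨆ (_ : 1 ≤ i ∧ i ≤ n), ⨆ j : Fin N,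
      MeasurableSpace.comap (fun ω => M i ω j) inferInstance

/-- The sequences `M⁽ʲ⁾_{n+1}` are martingale differences with respect to `ℱ_n`, and
`𝔼[‖M⁽ʲ⁾_{n+1}‖² | ℱ_n] ≤ K⁽ʲ⁾ (1 + ∑ₖ ‖x⁽ᵏ⁾_n‖²)` almost surely, with constants `K⁽ʲ⁾ > 0`. The
conditional expectation of the nonnegative variable `‖M⁽ʲ⁾_{n+1}‖²` is the `[0, ∞]`-valued one. -/
structure IsMartingaleNoise {N : ℕ} {d : Fin N → ℕ} {Ω : Type*} [MeasurableSpace Ω]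
    (μ : Measure Ω) (x M : ℕ → Ω → NState d) (K : Fin N → ℝ) : Prop where
  measurable : ∀ n j, Measurable (fun ω => M (n + 1) ω j)
  integrable : ∀ n j, Integrable (fun ω => M (n + 1) ω j) μ
  condExp_eq_zero : ∀ n j, μ[fun ω => M (n + 1) ω j | history x M n] =ᵐ[μ] 0
  const_pos : ∀ j, 0 < K j
  condLExp_le : ∀ n j, ∀ᵐ ω ∂μ,
    condLExp (history x M n) μ (fun ω => ‖M (n + 1) ω j‖ₑ ^ 2) ω ≤
      ENNReal.ofReal (K j * (1 + ∑ k, ‖x n ω k‖ ^ 2))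

/-- Step-size schedules on `N` timescales; a larger index means a slower timescale. -/
structure IsStepSizes {N : ℕ} (α : Fin N → ℕ → ℝ) : Prop where
  pos : ∀ j n, 0 < α j n
  sum_eq_top : ∀ j, Tendsto (fun n => ∑ k ∈ Finset.range n, α j k) atTop atTop
  summable_sq : Summable (fun n => ∑ j, α j n ^ 2)
  ratio : ∀ j k : Fin N, (j : ℕ) + 1 = k → Tendsto (fun n => α k n / α j n) atTop (𝓝 0)

/-- The condition on the scaled ODE of the `i`-th timescale. For the last index, `lamInf i` is a
point, and the last two fields say that this point is the origin of `ℝ^{d i}`. -/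
structure ScaledCondition {N : ℕ} {d : Fin N → ℕ}
    (h : (j : Fin N) → NState d → EuclideanSpace ℝ (Fin (d j)))
    (hInf : (i : Fin N) → NFrom d i → EuclideanSpace ℝ (Fin (d i)))
    (lamInf : (i : Fin N) → NAbove d i → EuclideanSpace ℝ (Fin (d i)))
    (i : Fin N) : Prop where
  limit : ∀ S : Set (NFrom d i), IsCompact S →
    TendstoUniformlyOn (fun (c : ℝ) y => scaledDrift h lamInf i c y) (hInf i) atTop S
  gas : ∀ p : NAbove d i,
    IsGASEquilibrium (fun u => hInf i (NFrom.cons i u p)) (lamInf i p)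
  lipschitz : ∃ L : ℝ≥0, LipschitzWith L (lamInf i)
  map_zero : lamInf i 0 = 0

/-- The condition on the unscaled ODE of the `i`-th timescale. For the last index, `lam i` is a
point `x⁽ᴺ⁾_*`. -/
def LimitCondition {N : ℕ} {d : Fin N → ℕ}
    (h : (j : Fin N) → NState d → EuclideanSpace ℝ (Fin (d j)))
    (lam : (i : Fin N) → NAbove d i → EuclideanSpace ℝ (Fin (d i)))
    (i : Fin N) : Prop :=
  ∀ p : NAbove d i,
    IsGASEquilibrium (fun u => h i (cascade lam i (NFrom.cons i u p))) (lam i p)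

end NTimescale

/-!
Divide the iterates by a scale `ρ` lying above their running maximum. The noise divided by the
running maximum is a martingale difference sequence with bounded second moments, so its sums
weighted by the square-summable step sizes converge almost surely; summation by parts turns this
into noise sums over late blocks of steps that are negligible relative to the running maximum. The
rescaled iterates are then approximate Euler schemes. Over blocks whose `i`-th clock advances by a
bounded amount, the components slower than the `i`-th freeze, the faster ones are slaved to the
slower ones through `lamInf`, and the `i`-th follows the ODE of `hInf i`, whose equilibrium attracts
uniformly from compact sets. Inductively, from the fastest timescale to the slowest, every component
is tracked by `lamInf` of the slower ones, and since `lamInf` vanishes at the origin, the rescaled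
iterates tend to zero. An unbounded sequence would contradict this at the times of a large new
maximum, where `ρ` can be taken to be the norm of the iterate.
-/

section ODE

variable {E : Type*} [NormedAddCommGroup E] [NormedSpace ℝ E] {f : E → E} {e : E} {L : ℝ≥0}

theorem dist_le_dist_mul_exp_of_isIntegralCurveOn (hf : LipschitzWith L f) {x y : ℝ → E}
    (hx : IsIntegralCurveOn x (fun _ => f) (Set.Ici 0))
    (hy : IsIntegralCurveOn y (fun _ => f) (Set.Ici 0)) {t : ℝ} (ht : 0 ≤ t) :
    dist (x t) (y t) ≤ dist (x 0) (y 0) * Real.exp (L * t) := by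
  have hcont : ∀ {z : ℝ → E}, IsIntegralCurveOn z (fun _ => f) (Set.Ici 0) →
      ContinuousOn z (Set.Icc 0 t) := fun hz s hs =>
    (hz s hs.1).continuousWithinAt.mono Set.Icc_subset_Ici_self
  have hder : ∀ {z : ℝ → E}, IsIntegralCurveOn z (fun _ => f) (Set.Ici 0) →
      ∀ s ∈ Set.Ico 0 t, HasDerivWithinAt z (f (z s)) (Set.Ici s) s := fun hz s hs =>
    (hz s hs.1).mono (Set.Ici_subset_Ici.2 hs.1)
  simpa using dist_le_of_trajectories_ODE (v := fun _ => f) (fun _ => hf) (hcont hx) (hder hx)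
    (hcont hy) (hder hy) le_rfl t ⟨ht, le_rfl⟩

theorem isIntegralCurveOn_Ici_comp_add {x : ℝ → E}
    (hx : IsIntegralCurveOn x (fun _ => f) (Set.Ici 0)) {T : ℝ} (hT : 0 ≤ T) :
    IsIntegralCurveOn (fun s => x (s + T)) (fun _ => f) (Set.Ici 0) :=
  (hx.comp_add T).mono fun s (hs : 0 ≤ s) => ⟨s + T, add_nonneg hs hT, by simp⟩

theorem IsGASEquilibrium.isIntegralCurveOn_const (h : IsGASEquilibrium f e) :
    IsIntegralCurveOn (fun _ => e) (fun _ => f) (Set.Ici 0) := fun t _ => by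
  simpa [h.equilibrium] using hasDerivWithinAt_const t (Set.Ici (0 : ℝ)) e

theorem IsGASEquilibrium.exists_ball_attraction (h : IsGASEquilibrium f e)
    (hf : LipschitzWith L f) (u : E) {δ : ℝ} (hδ : 0 < δ) :
    ∃ r > 0, ∃ T : ℝ, ∀ x : ℝ → E, IsIntegralCurveOn x (fun _ => f) (Set.Ici 0) →
      x 0 ∈ Metric.ball u r → ∀ t ≥ T, ‖x t - e‖ < δ := by
  obtain ⟨η, hη, hstable⟩ := h.stable δ hδ
  obtain ⟨X, hX0, hX⟩ := h.exists_solution u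
  obtain ⟨T, hXT, hT⟩ : ∃ T, dist (X T) e < η / 2 ∧ 0 ≤ T :=
    ((Metric.tendsto_nhds.1 (h.attractive X hX) _ (half_pos hη)).and
      (eventually_ge_atTop 0)).exists
  refine ⟨η / 2 * Real.exp (-(L * T)), by positivity, T, fun x hx hx0 t ht => ?_⟩
  have hnear : dist (x T) (X T) < η / 2 := by
    calc dist (x T) (X T) ≤ dist (x 0) u * Real.exp (L * T) :=
          hX0 ▸ dist_le_dist_mul_exp_of_isIntegralCurveOn hf hx hX hT
      _ < η / 2 * Real.exp (-(L * T)) * Real.exp (L * T) := by gcongr; exact hx0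
      _ = η / 2 := by rw [mul_assoc, ← Real.exp_add]; simp
  have henter : ‖x T - e‖ < η := by
    rw [← dist_eq_norm]
    linarith [dist_triangle (x T) (X T) e]
  simpa using hstable _ (isIntegralCurveOn_Ici_comp_add hx hT) (by simpa using henter) (t - T)
    (sub_nonneg.2 ht)

theorem IsGASEquilibrium.uniform_attraction (h : IsGASEquilibrium f e) (hf : LipschitzWith L f)
    {S : Set E} (hS : IsCompact S) {δ : ℝ} (hδ : 0 < δ) :
    ∃ T : ℝ, ∀ x : ℝ → E, IsIntegralCurveOn x (fun _ => f) (Set.Ici 0) → x 0 ∈ S →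
      ∀ t ≥ T, ‖x t - e‖ < δ := by
  refine hS.induction_on ⟨0, fun _ _ h => h.elim⟩ ?_ ?_ fun u _ => ?_
  · exact fun s t hst ⟨T, hT⟩ => ⟨T, fun x hx hx0 => hT x hx (hst hx0)⟩
  · exact fun s t ⟨T, hT⟩ ⟨T', hT'⟩ => ⟨max T T', fun x hx hx0 τ hτ => hx0.elim
      (fun h0 => hT x hx h0 τ (le_of_max_le_left hτ))
      (fun h0 => hT' x hx h0 τ (le_of_max_le_right hτ))⟩
  · obtain ⟨r, hr, hball⟩ := h.exists_ball_attraction hf u hδ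
    exact ⟨_, mem_nhdsWithin_of_mem_nhds (Metric.ball_mem_nhds u hr), hball⟩

theorem norm_sub_sub_smul_le_of_isIntegralCurveOn (hf : LipschitzWith L f) {u : ℝ → E}
    (hu : IsIntegralCurveOn u (fun _ => f) (Set.Ici 0)) {C s a : ℝ} (hs : 0 ≤ s) (ha : 0 ≤ a)
    (hC : ∀ t ∈ Set.Icc s (s + a), ‖f (u t)‖ ≤ C) :
    ‖u (s + a) - u s - a • f (u s)‖ ≤ L * C * a ^ 2 := by
  have hderiv : ∀ t ∈ Set.Icc s (s + a),
      HasDerivWithinAt u (f (u t)) (Set.Icc s (s + a)) t := fun t ht =>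
    (hu t (hs.trans ht.1)).mono fun t ht => hs.trans ht.1
  have hincr : ∀ t ∈ Set.Icc s (s + a), ‖u t - u s‖ ≤ C * (t - s) :=
    norm_image_sub_le_of_norm_deriv_le_segment' hderiv fun t ht => hC t ⟨ht.1, ht.2.le⟩
  have hC0 : 0 ≤ C := (norm_nonneg _).trans (hC s ⟨le_rfl, by linarith⟩)
  have hmain := norm_image_sub_le_of_norm_deriv_le_segment' (f := fun t => u t - t • f (u s))
    (f' := fun t => f (u t) - f (u s)) (C := L * (C * a)) (a := s) (b := s + a)
    (fun t ht => (hderiv t ht).sub (by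
      simpa using (hasDerivWithinAt_id t _).smul_const (f (u s))))
    (fun t ht => by
      calc ‖f (u t) - f (u s)‖ ≤ L * ‖u t - u s‖ := hf.norm_sub_le _ _
        _ ≤ L * (C * (t - s)) := by gcongr; exact hincr t ⟨ht.1, ht.2.le⟩
        _ ≤ L * (C * a) := by gcongr; linarith [ht.2])
    (s + a) ⟨by linarith, le_rfl⟩
  calc ‖u (s + a) - u s - a • f (u s)‖
      = ‖u (s + a) - (s + a) • f (u s) - (u s - s • f (u s))‖ := by congr 1; module
    _ ≤ L * (C * a) * (s + a - s) := hmain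
    _ = L * C * a ^ 2 := by ring

theorem norm_add_smul_sub_le_of_isIntegralCurveOn (hf : LipschitzWith L f) {u : ℝ → E}
    (hu : IsIntegralCurveOn u (fun _ => f) (Set.Ici 0)) {C s a : ℝ} (hs : 0 ≤ s) (ha : 0 ≤ a)
    (hC : ∀ t ∈ Set.Icc s (s + a), ‖f (u t)‖ ≤ C) (v y : E) :
    ‖v + a • f y - u (s + a)‖
      ≤ ‖v - u s‖ + L * a * (‖v - u s‖ + ‖y - v‖) + L * C * a ^ 2 := by
  have hslope : ‖f y - f (u s)‖ ≤ L * (‖v - u s‖ + ‖y - v‖) := by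
    refine (hf.norm_sub_le y (u s)).trans ?_
    gcongr
    simpa only [sub_add_sub_cancel', add_comm] using norm_add_le (v - u s) (y - v)
  calc ‖v + a • f y - u (s + a)‖
      = ‖v - u s + a • (f y - f (u s)) - (u (s + a) - u s - a • f (u s))‖ := by
        congr 1; module
    _ ≤ ‖v - u s‖ + a * ‖f y - f (u s)‖ + ‖u (s + a) - u s - a • f (u s)‖ := by
        refine (norm_sub_le _ _).trans (add_le_add_left (norm_add_le_of_le le_rfl ?_) _)
        rw [norm_smul, Real.norm_of_nonneg ha]
    _ ≤ ‖v - u s‖ + a * (L * (‖v - u s‖ + ‖y - v‖)) + L * C * a ^ 2 := by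
        gcongr
        exact norm_sub_sub_smul_le_of_isIntegralCurveOn hf hu hs ha hC
    _ = _ := by ring

/-- On the window `[m, n]`, the sequence `y` follows the Euler scheme for `ẋ = f x` with step
sizes `a`, up to an error `ε`. The error is measured after summation, so that oscillating
perturbations which only cancel over many steps are allowed. -/
structure IsApproxEuler (f : E → E) (ε : ℝ) (a : ℕ → ℝ) (y : ℕ → E) (m n : ℕ) : Prop where
  step_nonneg : ∀ k ∈ Finset.Ico m n, 0 ≤ a k
  step_le : ∀ k ∈ Finset.Ico m n, a k ≤ ε
  norm_sub_sum_le : ∀ k ∈ Finset.Icc m n,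
    ‖y k - y m - ∑ i ∈ Finset.Ico m k, a i • f (y i)‖ ≤ ε

theorem IsApproxEuler.of_le {ε : ℝ} {a : ℕ → ℝ} {y : ℕ → E} {m k n : ℕ}
    (hy : IsApproxEuler f ε a y m n) (hkn : k ≤ n) : IsApproxEuler f ε a y m k where
  step_nonneg i hi := hy.step_nonneg i (Finset.Ico_subset_Ico_right hkn hi)
  step_le i hi := hy.step_le i (Finset.Ico_subset_Ico_right hkn hi)
  norm_sub_sum_le i hi := hy.norm_sub_sum_le i (Finset.Icc_subset_Icc_right hkn hi)

theorem IsApproxEuler.norm_add_sum_sub_add_le {ε : ℝ} {a : ℕ → ℝ} {y : ℕ → E} {m n : ℕ}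
    (hy : IsApproxEuler f ε a y m n) (hmn : m ≤ n) (hf : LipschitzWith L f) {u : ℝ → E}
    (hu : IsIntegralCurveOn u (fun _ => f) (Set.Ici 0)) (hu0 : u 0 = y m) {C : ℝ}
    (hC0 : 0 ≤ C) (hC : ∀ t ∈ Set.Icc 0 (∑ i ∈ Finset.Ico m n, a i), ‖f (u t)‖ ≤ C) :
    ‖y m + ∑ i ∈ Finset.Ico m n, a i • f (y i) - u (∑ i ∈ Finset.Ico m n, a i)‖ + ε * (1 + C)
      ≤ ε * (1 + C) * Real.exp (L * ∑ i ∈ Finset.Ico m n, a i) := by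
  induction n, hmn using Nat.le_induction with
  | base => simp [hu0]
  | succ n hmn ih =>
    have hn : n ∈ Finset.Ico m (n + 1) := Finset.mem_Ico.2 ⟨hmn, n.lt_succ_self⟩
    have ha := hy.step_nonneg n hn
    have hdev := hy.norm_sub_sum_le n (Finset.Ico_subset_Icc_self hn)
    have hε : 0 ≤ ε := (norm_nonneg _).trans hdev
    have hy' := hy.of_le n.le_succ
    have hτ : 0 ≤ ∑ i ∈ Finset.Ico m n, a i := Finset.sum_nonneg hy'.step_nonneg
    simp only [Finset.sum_Ico_succ_top hmn, ← add_assoc] at hC ⊢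
    replace ih := ih hy' fun t ht => hC t ⟨ht.1, ht.2.trans (le_add_of_nonneg_right ha)⟩
    have hstep := norm_add_smul_sub_le_of_isIntegralCurveOn hf hu hτ ha
      (fun t ht => hC t ⟨hτ.trans ht.1, ht.2⟩) (y m + ∑ i ∈ Finset.Ico m n, a i • f (y i)) (y n)
    rw [sub_sub] at hdev
    set τ := ∑ i ∈ Finset.Ico m n, a i
    set v := y m + ∑ i ∈ Finset.Ico m n, a i • f (y i)
    calc ‖v + a n • f (y n) - u (τ + a n)‖ + ε * (1 + C)
        ≤ ‖v - u τ‖ + L * a n * (‖v - u τ‖ + ‖y n - v‖) + L * C * a n ^ 2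
          + ε * (1 + C) := by gcongr
      _ ≤ ‖v - u τ‖ + L * a n * (‖v - u τ‖ + ε) + L * C * (a n * ε) + ε * (1 + C) := by
        rw [sq]
        gcongr
        exact hy.step_le n hn
      _ = (‖v - u τ‖ + ε * (1 + C)) * (L * a n + 1) := by ring
      _ ≤ ε * (1 + C) * Real.exp (L * τ) * Real.exp (L * a n) := by
        gcongr
        exact Real.add_one_le_exp _
      _ = ε * (1 + C) * Real.exp (L * (τ + a n)) := by
        rw [mul_assoc, ← Real.exp_add, ← mul_add]

theorem IsApproxEuler.norm_sub_le_mul_exp {ε : ℝ} {a : ℕ → ℝ} {y : ℕ → E} {m n : ℕ}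
    (hy : IsApproxEuler f ε a y m n) (hmn : m ≤ n) (hf : LipschitzWith L f) {u : ℝ → E}
    (hu : IsIntegralCurveOn u (fun _ => f) (Set.Ici 0)) (hu0 : u 0 = y m) {C : ℝ}
    (hC0 : 0 ≤ C) (hC : ∀ t ∈ Set.Icc 0 (∑ i ∈ Finset.Ico m n, a i), ‖f (u t)‖ ≤ C) :
    ‖y n - u (∑ i ∈ Finset.Ico m n, a i)‖
      ≤ ε * (1 + C) * Real.exp (L * ∑ i ∈ Finset.Ico m n, a i) := by
  have hdev := hy.norm_sub_sum_le n (Finset.right_mem_Icc.2 hmn)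
  rw [sub_sub] at hdev
  have hε : 0 ≤ ε := (norm_nonneg _).trans hdev
  calc ‖y n - u (∑ i ∈ Finset.Ico m n, a i)‖
      ≤ ‖y n - (y m + ∑ i ∈ Finset.Ico m n, a i • f (y i))‖
        + ‖y m + ∑ i ∈ Finset.Ico m n, a i • f (y i) - u (∑ i ∈ Finset.Ico m n, a i)‖ :=
        norm_sub_le_norm_sub_add_norm_sub ..
    _ ≤ ‖y m + ∑ i ∈ Finset.Ico m n, a i • f (y i) - u (∑ i ∈ Finset.Ico m n, a i)‖
        + ε * (1 + C) := by linarith [mul_nonneg hε hC0]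
    _ ≤ _ := hy.norm_add_sum_sub_add_le hmn hf hu hu0 hC0 hC

theorem IsGASEquilibrium.exists_isApproxEuler_tracking [ProperSpace E]
    (h : IsGASEquilibrium f e) (hf : LipschitzWith L f) (r : ℝ) {δ : ℝ} (hδ : 0 < δ) :
    ∃ T : ℝ, 0 ≤ T ∧ ∃ ε > 0, ∀ (a : ℕ → ℝ) (y : ℕ → E) (m n : ℕ), m ≤ n →
      IsApproxEuler f ε a y m n → ∑ k ∈ Finset.Ico m n, a k ∈ Set.Icc T (T + 1) →
      ‖y m‖ ≤ r → ‖y n - e‖ ≤ δ := by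
  obtain ⟨T, hT⟩ := h.uniform_attraction hf (isCompact_closedBall (0 : E) r) (half_pos hδ)
  set C := L * (max 0 (r + ‖e‖) * Real.exp (L * (max 0 T + 1)))
  set G := (1 + C) * Real.exp (L * (max 0 T + 1))
  have hC0 : 0 ≤ C := by positivity
  refine ⟨max 0 T, le_max_left _ _, δ / 2 / G, by positivity, fun a y m n hmn hy hτ hr => ?_⟩
  obtain ⟨u, hu0, hu⟩ := h.exists_solution (y m)
  have hslope : ∀ t ∈ Set.Icc 0 (∑ k ∈ Finset.Ico m n, a k), ‖f (u t)‖ ≤ C := fun t ht => by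
    have hdist := dist_le_dist_mul_exp_of_isIntegralCurveOn hf hu h.isIntegralCurveOn_const ht.1
    have hstart : dist (u 0) e ≤ max 0 (r + ‖e‖) := by
      rw [hu0, dist_eq_norm]
      exact le_max_of_le_right ((norm_sub_le _ _).trans (by gcongr))
    calc ‖f (u t)‖ = ‖f (u t) - f e‖ := by rw [h.equilibrium, sub_zero]
      _ ≤ L * dist (u t) e := by rw [dist_eq_norm]; exact hf.norm_sub_le _ _
      _ ≤ L * (max 0 (r + ‖e‖) * Real.exp (L * (max 0 T + 1))) := by
        gcongr
        refine hdist.trans ?_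
        gcongr
        exact ht.2.trans hτ.2
  have hnear : ‖y n - u (∑ k ∈ Finset.Ico m n, a k)‖ ≤ δ / 2 := by
    refine (hy.norm_sub_le_mul_exp hmn hf hu hu0 hC0 hslope).trans ?_
    calc δ / 2 / G * (1 + C) * Real.exp (L * ∑ k ∈ Finset.Ico m n, a k)
        ≤ δ / 2 / G * (1 + C) * Real.exp (L * (max 0 T + 1)) := by gcongr; exact hτ.2
      _ = δ / 2 := by rw [mul_assoc]; exact div_mul_cancel₀ _ (by positivity)
  have hflow := hT u hu (by simpa [hu0] using hr) _ (le_of_max_le_right hτ.1)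
  linarith [norm_sub_le_norm_sub_add_norm_sub (y n) (u (∑ k ∈ Finset.Ico m n, a k)) e]

end ODE

section StepSizes

theorem exists_tendsto_atTop_sum_Ico_mem_Icc {a : ℕ → ℝ}
    (hdiv : Tendsto (fun n => ∑ k ∈ Finset.range n, a k) atTop atTop)
    (ha : Tendsto a atTop (𝓝 0)) {T : ℝ} (hT : 0 ≤ T) :
    ∃ m : ℕ → ℕ, Tendsto m atTop atTop ∧ (∀ n, m n ≤ n) ∧
      ∀ᶠ n in atTop, ∑ k ∈ Finset.Ico (m n) n, a k ∈ Set.Icc T (T + 1) := by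
  set P : ℕ → ℕ → Prop := fun n m => T ≤ ∑ k ∈ Finset.Ico m n, a k
  have hP : ∀ b, ∀ᶠ n in atTop, b ≤ n ∧ P n b := fun b => by
    filter_upwards [eventually_ge_atTop b,
      hdiv.eventually_ge_atTop (T + ∑ k ∈ Finset.range b, a k)] with n hbn hn
    refine ⟨hbn, ?_⟩
    simp only [P, Finset.sum_Ico_eq_sub a hbn]
    linarith
  have hm : Tendsto (fun n => Nat.findGreatest (P n) n) atTop atTop :=
    tendsto_atTop.2 fun b => (hP b).mono fun n hn => Nat.le_findGreatest hn.1 hn.2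
  refine ⟨_, hm, fun n => Nat.findGreatest_le n, ?_⟩
  filter_upwards [hP 0, hm.eventually (ha.eventually_le_const one_pos)] with n hn hstep
  set m := Nat.findGreatest (P n) n
  have hPm : P n m := Nat.findGreatest_spec hn.1 hn.2
  have hle : m ≤ n := Nat.findGreatest_le n
  refine ⟨hPm, ?_⟩
  obtain hmn | hmn := hle.lt_or_eq
  · have hmax : ¬ P n (m + 1) := Nat.findGreatest_is_greatest m.lt_succ_self hmn
    rw [Finset.sum_eq_sum_Ico_succ_bot hmn]
    linarith [not_le.1 hmax]
  · rw [hmn, Finset.Ico_self, Finset.sum_empty]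
    positivity

theorem tendsto_sum_Ico_zero_of_tendsto_div_zero {a b : ℕ → ℝ} (ha : ∀ n, 0 < a n)
    (hb : ∀ n, 0 ≤ b n) (hba : Tendsto (fun n => b n / a n) atTop (𝓝 0)) {m : ℕ → ℕ}
    (hm : Tendsto m atTop atTop) {B : ℝ}
    (hB : ∀ᶠ n in atTop, ∑ k ∈ Finset.Ico (m n) n, a k ≤ B) :
    Tendsto (fun n => ∑ k ∈ Finset.Ico (m n) n, b k) atTop (𝓝 0) := by
  refine Metric.tendsto_nhds.2 fun ε hε => ?_
  have hκ : 0 < ε / (|B| + 1) := by positivity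
  filter_upwards [hB, hm.eventually (eventually_forall_ge_atTop.2 (hba.eventually_le_const hκ))]
    with n hBn hratio
  rw [Real.dist_0_eq_abs, abs_of_nonneg (Finset.sum_nonneg fun k _ => hb k)]
  calc ∑ k ∈ Finset.Ico (m n) n, b k ≤ ∑ k ∈ Finset.Ico (m n) n, ε / (|B| + 1) * a k :=
        Finset.sum_le_sum fun k hk =>
          (div_le_iff₀ (ha k)).1 (hratio k (Finset.mem_Ico.1 hk).1)
    _ = ε / (|B| + 1) * ∑ k ∈ Finset.Ico (m n) n, a k := by rw [Finset.mul_sum]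
    _ ≤ ε / (|B| + 1) * |B| := by gcongr; exact hBn.trans (le_abs_self B)
    _ < ε / (|B| + 1) * (|B| + 1) := by gcongr; linarith
    _ = ε := div_mul_cancel₀ _ (by positivity)

variable {N : ℕ} {α : Fin N → ℕ → ℝ}

theorem IsStepSizes.summable_sq_apply (hα : IsStepSizes α) (j : Fin N) :
    Summable (fun n => α j n ^ 2) :=
  hα.summable_sq.of_nonneg_of_le (fun _ => sq_nonneg _) fun n =>
    Finset.single_le_sum (f := fun j => α j n ^ 2) (fun _ _ => sq_nonneg _) (Finset.mem_univ j)

theorem IsStepSizes.tendsto_zero (hα : IsStepSizes α) (j : Fin N) :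
    Tendsto (α j) atTop (𝓝 0) := by
  simpa [Real.sqrt_sq (hα.pos j _).le] using (hα.summable_sq_apply j).tendsto_atTop_zero.sqrt

theorem IsStepSizes.tendsto_ratio (hα : IsStepSizes α) {i l : Fin N} (hil : i < l) :
    Tendsto (fun n => α l n / α i n) atTop (𝓝 0) := by
  obtain ⟨l, hl⟩ := l
  induction l with
  | zero => exact absurd hil (by simp [Fin.lt_def])
  | succ l ih =>
    have hl' : l < N := by omega
    have hstep := hα.ratio ⟨l, hl'⟩ ⟨l + 1, hl⟩ rfl
    obtain hlt | heq := (Nat.lt_succ_iff.1 (Fin.lt_def.1 hil)).lt_or_eq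
    · have hmul := hstep.mul (ih hl' (Fin.lt_def.2 hlt))
      rw [mul_zero] at hmul
      exact hmul.congr fun n => div_mul_div_cancel₀ (hα.pos ⟨l, hl'⟩ n).ne'
    · rwa [show i = ⟨l, hl'⟩ from Fin.ext heq]

end StepSizes

section Cascade

theorem exists_lipschitzWith_pi {X ι : Type*} {Y : ι → Type*} [PseudoEMetricSpace X] [Fintype ι]
    [∀ i, PseudoEMetricSpace (Y i)] {g : X → ∀ i, Y i}
    (hg : ∀ i, ∃ C : ℝ≥0, LipschitzWith C fun x => g x i) : ∃ C : ℝ≥0, LipschitzWith C g := by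
  choose C hC using hg
  refine ⟨Finset.univ.sup C, fun x y => edist_pi_le_iff.2 fun i => (hC i x y).trans ?_⟩
  gcongr
  exact Finset.le_sup (Finset.mem_univ i)

theorem tendsto_sub_zero_of_lipschitzWith {X Y ι : Type*} [SeminormedAddCommGroup X]
    [SeminormedAddCommGroup Y] {C : ℝ≥0} {g : X → Y} (hg : LipschitzWith C g) {F : Filter ι}
    {u v : ι → X} (huv : Tendsto (fun q => u q - v q) F (𝓝 0)) :
    Tendsto (fun q => g (u q) - g (v q)) F (𝓝 0) :=
  squeeze_zero_norm (fun q => hg.norm_sub_le (u q) (v q))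
    (by simpa using huv.norm.const_mul (C : ℝ))

variable {N : ℕ} {d : Fin N → ℕ}

/-- The components `(z⁽ⁱ⁺¹⁾, …, z⁽ᴺ⁾)` of a full tuple `z`, on which a drift on timescale `i`
depends through its equilibrium. -/
abbrev aboveOf (i : Fin N) (z : NState d) : NAbove d i :=
  fun l => z l.1

/-- The components `(z⁽ⁱ⁾, …, z⁽ᴺ⁾)` of a full tuple `z`, which determine the remaining ones
through `cascade`. -/
abbrev fromOf (i : Fin N) (z : NState d) : NFrom d i :=
  fun l => z l.1

theorem NFrom.cons_aboveOf (i : Fin N) (z : NState d) :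
    NFrom.cons i (z i) (aboveOf i z) = fromOf i z := by
  funext ⟨l, hl⟩
  obtain hlt | rfl := hl.lt_or_eq
  · exact NFrom.cons_of_lt i _ _ l hlt
  · exact NFrom.cons_self _ _ _

theorem NFrom.norm_cons_sub_cons_le (i : Fin N) (u v : EuclideanSpace ℝ (Fin (d i)))
    (p q : NAbove d i) : ‖NFrom.cons i u p - NFrom.cons i v q‖ ≤ max ‖u - v‖ ‖p - q‖ := by
  refine (pi_norm_le_iff_of_nonneg (by positivity)).2 fun ⟨l, hl⟩ => ?_
  rw [Pi.sub_apply]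
  obtain hlt | rfl := hl.lt_or_eq
  · rw [NFrom.cons_of_lt i _ _ l hlt, NFrom.cons_of_lt i _ _ l hlt]
    exact (norm_le_pi_norm (p - q) ⟨l, hlt⟩).trans (le_max_right _ _)
  · rw [NFrom.cons_self, NFrom.cons_self]
    exact le_max_left _ _

theorem NFrom.lipschitzWith_cons (i : Fin N) (p : NAbove d i) :
    LipschitzWith 1 (fun u => NFrom.cons i u p) :=
  LipschitzWith.of_dist_le_mul fun u v => by
    simpa [dist_eq_norm] using NFrom.norm_cons_sub_cons_le i u v p p

variable {lam : (i : Fin N) → NAbove d i → EuclideanSpace ℝ (Fin (d i))}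

theorem cascade_of_le {i j : Fin N} (y : NFrom d i) (hij : i ≤ j) :
    cascade lam i y j = y ⟨j, hij⟩ := by
  rw [cascade, dif_pos hij]

theorem cascade_of_lt {i j : Fin N} (y : NFrom d i) (hji : j < i) :
    cascade lam i y j = lam j (aboveOf j (cascade lam i y)) := by
  rw [cascade, dif_neg hji.not_ge]

theorem exists_lipschitzWith_cascade (hlam : ∀ j, ∃ C : ℝ≥0, LipschitzWith C (lam j))
    (i : Fin N) : ∃ C : ℝ≥0, LipschitzWith C fun y => (cascade lam i y : NState d) := by
  refine exists_lipschitzWith_pi fun j => ?_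
  induction j using WellFoundedGT.induction with
  | ind j ih =>
    obtain hij | hji := le_or_gt i j
    · exact ⟨1, by simpa only [cascade_of_le _ hij] using LipschitzWith.eval _⟩
    · obtain ⟨C, hC⟩ := hlam j
      obtain ⟨D, hD⟩ : ∃ D : ℝ≥0, LipschitzWith D fun y => aboveOf j (cascade lam i y) :=
        exists_lipschitzWith_pi fun l => ih l.1 l.2
      exact ⟨C * D, by simpa only [cascade_of_lt _ hji] using! hC.comp hD⟩

theorem tendsto_zero_of_aboveOf {ι : Type*} {F : Filter ι} {v : ι → NState d}
    (hv : ∀ j, Tendsto (fun q => aboveOf j (v q)) F (𝓝 0) →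
      Tendsto (fun q => v q j) F (𝓝 0)) : Tendsto v F (𝓝 0) := by
  refine tendsto_pi_nhds.2 fun j => ?_
  induction j using WellFoundedGT.induction with
  | ind j ih => exact hv j (tendsto_pi_nhds.2 fun l => ih l.1 l.2)

theorem tendsto_sub_cascade_zero (hlam : ∀ j, ∃ C : ℝ≥0, LipschitzWith C (lam j)) {i : Fin N}
    {ι : Type*} {F : Filter ι} {z : ι → NState d}
    (hz : ∀ j < i, Tendsto (fun q => z q j - lam j (aboveOf j (z q))) F (𝓝 0)) :
    Tendsto (fun q => z q - cascade lam i (fromOf i (z q))) F (𝓝 0) := by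
  refine tendsto_zero_of_aboveOf fun j hj => ?_
  obtain hij | hji := le_or_gt i j
  · simp [cascade_of_le _ hij, tendsto_const_nhds]
  · obtain ⟨C, hC⟩ := hlam j
    simpa [cascade_of_lt _ hji] using
      (hz j hji).add (tendsto_sub_zero_of_lipschitzWith hC (u := fun q => aboveOf j (z q)) hj)

theorem tendsto_zero_of_tendsto_sub_map_aboveOf
    (hlam : ∀ j, ∃ C : ℝ≥0, LipschitzWith C (lam j)) (hlam0 : ∀ j, lam j 0 = 0) {ι : Type*}
    {F : Filter ι} {z : ι → NState d}
    (hz : ∀ j, Tendsto (fun q => z q j - lam j (aboveOf j (z q))) F (𝓝 0)) :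
    Tendsto z F (𝓝 0) := by
  refine tendsto_zero_of_aboveOf fun j hj => ?_
  obtain ⟨C, hC⟩ := hlam j
  simpa [hlam0 j] using (hz j).add ((hC.continuous.tendsto 0).comp hj)

variable {h : (j : Fin N) → NState d → EuclideanSpace ℝ (Fin (d j))} {i : Fin N}

theorem norm_inv_smul_sub_scaledDrift_le {C : ℝ≥0} (hh : LipschitzWith C (h i)) {c : ℝ}
    (hc : 0 < c) (y : NFrom d i) (z : NState d) :
    ‖c⁻¹ • h i (c • z) - scaledDrift h lam i c y‖ ≤ C * ‖z - cascade lam i y‖ := by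
  calc ‖c⁻¹ • h i (c • z) - scaledDrift h lam i c y‖
      = c⁻¹ * ‖h i (c • z) - h i (c • (cascade lam i y : NState d))‖ := by
        rw [← norm_smul_of_nonneg (inv_nonneg.2 hc.le), smul_sub]
        rfl
    _ ≤ c⁻¹ * (C * ‖c • z - c • (cascade lam i y : NState d)‖) := by
        gcongr
        exact hh.norm_sub_le _ _
    _ = C * ‖z - cascade lam i y‖ := by
        rw [← smul_sub, norm_smul_of_nonneg hc.le]
        field_simp

theorem ScaledCondition.exists_lipschitzWith {hInf : (i : Fin N) → NFrom d i →
      EuclideanSpace ℝ (Fin (d i))} (hB : ScaledCondition h hInf lam i)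
    (hh : ∃ C : ℝ≥0, LipschitzWith C (h i)) (hlam : ∀ j, ∃ C : ℝ≥0, LipschitzWith C (lam j)) :
    ∃ C : ℝ≥0, LipschitzWith C (hInf i) := by
  obtain ⟨C, hC⟩ := hh
  obtain ⟨D, hD⟩ := exists_lipschitzWith_cascade hlam i
  have hlim : ∀ y, Tendsto (fun c => scaledDrift h lam i c y) atTop (𝓝 (hInf i y)) :=
    fun y => (hB.limit {y} isCompact_singleton).tendsto_at rfl
  refine ⟨C * D, LipschitzWith.of_dist_le_mul fun y z =>
    le_of_tendsto ((hlim y).dist (hlim z)) ?_⟩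
  filter_upwards [eventually_gt_atTop 0] with c hc
  rw [dist_eq_norm, dist_eq_norm]
  calc ‖scaledDrift h lam i c y - scaledDrift h lam i c z‖
      ≤ C * ‖(cascade lam i y : NState d) - cascade lam i z‖ :=
        norm_inv_smul_sub_scaledDrift_le hC hc z (cascade lam i y)
    _ ≤ C * (D * ‖y - z‖) := by gcongr; exact hD.norm_sub_le y z
    _ = ↑(C * D) * ‖y - z‖ := by push_cast; ring

end Cascade

section RunningBound

variable {V : Type*} [NormedAddCommGroup V] {x : ℕ → V}

/-- The running maximum `max (1, ‖x 0‖, …, ‖x n‖)` of a sequence, the normalization of the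
iterates and of the noise. -/
noncomputable def runningBound (x : ℕ → V) : ℕ →o ℝ :=
  partialSups fun k => max 1 ‖x k‖

theorem one_le_runningBound (n : ℕ) : 1 ≤ runningBound x n :=
  (le_max_left _ _).trans (le_partialSups (fun k => max 1 ‖x k‖) n)

theorem runningBound_pos (n : ℕ) : 0 < runningBound x n :=
  one_pos.trans_le (one_le_runningBound n)

theorem norm_le_runningBound (n : ℕ) : ‖x n‖ ≤ runningBound x n :=
  (le_max_right _ _).trans (le_partialSups (fun k => max 1 ‖x k‖) n)

/-- The filter of pairs `(n, ρ)` with `n → ∞`, `ρ → ∞` and `ρ` above the running maximum of `x`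
at time `n`; limits along it describe `x` near a large new maximum. -/
def scalesAbove (x : ℕ → V) : Filter (ℕ × ℝ) :=
  atTop ⊓ 𝓟 {q | runningBound x q.1 ≤ q.2}

theorem eventually_runningBound_le : ∀ᶠ q in scalesAbove x, runningBound x q.1 ≤ q.2 :=
  mem_inf_of_right (mem_principal_self _)

theorem tendsto_fst_scalesAbove : Tendsto Prod.fst (scalesAbove x) atTop := by
  rw [scalesAbove, ← prod_atTop_atTop_eq]
  exact tendsto_fst.mono_left inf_le_left

theorem tendsto_snd_scalesAbove : Tendsto Prod.snd (scalesAbove x) atTop := by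
  rw [scalesAbove, ← prod_atTop_atTop_eq]
  exact tendsto_snd.mono_left inf_le_left

/-- The sequence `x` divided by the scale `ρ`, as a function of the pair `(n, ρ)`. -/
noncomputable def rescaled {W : Type*} [SMul ℝ W] (x : ℕ → W) (q : ℕ × ℝ) : W :=
  q.2⁻¹ • x q.1

theorem norm_rescaled_comp_le {W : Type*} [NormedAddCommGroup W] [NormedSpace ℝ W] {C : ℝ≥0}
    {g : V → W} (hg : LipschitzWith C g) {q : ℕ × ℝ} (hq : runningBound x q.1 ≤ q.2) :
    ‖rescaled (fun k => g (x k)) q‖ ≤ C + ‖g 0‖ := by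
  have hone : 1 ≤ q.2 := (one_le_runningBound _).trans hq
  have hpos : 0 < q.2 := one_pos.trans_le hone
  rw [rescaled, norm_smul_of_nonneg (inv_nonneg.2 hpos.le), inv_mul_le_iff₀ hpos]
  calc ‖g (x q.1)‖ ≤ C * ‖x q.1‖ + ‖g 0‖ := by
        simpa using norm_le_norm_sub_add (g (x q.1)) (g 0) |>.trans
          (add_le_add_left (hg.norm_sub_le (x q.1) 0) _)
    _ ≤ C * q.2 + q.2 * ‖g 0‖ := by
        gcongr
        · exact (norm_le_runningBound _).trans hq
        · exact le_mul_of_one_le_left (norm_nonneg _) hone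
    _ = q.2 * (C + ‖g 0‖) := by ring

variable [NormedSpace ℝ V]

theorem norm_rescaled_le_one {q : ℕ × ℝ} (hq : runningBound x q.1 ≤ q.2) :
    ‖rescaled x q‖ ≤ 1 := by
  have hpos : 0 < q.2 := (runningBound_pos _).trans_le hq
  rw [rescaled, norm_smul_of_nonneg (inv_nonneg.2 hpos.le), inv_mul_le_iff₀ hpos, mul_one]
  exact (norm_le_runningBound _).trans hq

/-- A new maximum of `‖x n‖` would be a rescaled iterate of norm one. -/
theorem bddAbove_norm_of_tendsto_rescaled (hx : Tendsto (rescaled x) (scalesAbove x) (𝓝 0)) :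
    BddAbove (Set.range fun n => ‖x n‖) := by
  have hhalf : ∀ᶠ q in scalesAbove x, ‖rescaled x q‖ ≤ 1 / 2 :=
    (tendsto_zero_iff_norm_tendsto_zero.1 hx).eventually_le_const one_half_pos
  rw [scalesAbove, eventually_inf_principal, eventually_atTop] at hhalf
  obtain ⟨⟨n₀, c₀⟩, hhalf⟩ := hhalf
  set C := max c₀ (runningBound x n₀)
  have hC : 1 ≤ C := (one_le_runningBound n₀).trans (le_max_right _ _)
  have hbound : ∀ n, n₀ ≤ n → runningBound x n ≤ C := by
    intro n hn
    induction n, hn using Nat.le_induction with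
    | base => exact le_max_right _ _
    | succ n hn ih =>
      have hsucc : runningBound x (n + 1) = max (runningBound x n) (max 1 ‖x (n + 1)‖) :=
        partialSups_add_one _ n
      have hscale : runningBound x (n + 1) ≤ max C ‖x (n + 1)‖ := by
        rw [hsucc]
        exact max_le (le_max_of_le_left ih) (max_le_max_right _ hC)
      have hsmall := hhalf (n + 1, max C ‖x (n + 1)‖)
        ⟨hn.trans n.le_succ, (le_max_left _ _).trans (le_max_left _ _)⟩ hscale
      have hpos : 0 < max C ‖x (n + 1)‖ := lt_max_of_lt_left (one_pos.trans_le hC)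
      rw [rescaled, norm_smul_of_nonneg (inv_nonneg.2 hpos.le), inv_mul_le_iff₀ hpos] at hsmall
      rw [hsucc]
      refine max_le ih (max_le hC (not_lt.1 fun hlt => ?_))
      simp only [max_eq_right hlt.le] at hsmall
      linarith
  refine ⟨C, ?_⟩
  rintro _ ⟨n, rfl⟩
  exact (norm_le_runningBound n).trans (((runningBound x).monotone (le_max_left n n₀)).trans
    (hbound _ (le_max_right n n₀)))

end RunningBound

section Windows

variable {m : ℕ → ℕ} {F G : Filter (ℕ × ℝ)}

/-- The filter of triples `(k, n, ρ)` with `(n, ρ)` along `F` and `k` in the window `[m n, n]`: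
limits along it are limits along `F` that are uniform over the window. -/
def windows (m : ℕ → ℕ) (F : Filter (ℕ × ℝ)) : Filter (ℕ × ℕ × ℝ) :=
  comap Prod.snd F ⊓ 𝓟 {w | w.1 ∈ Finset.Icc (m w.2.1) w.2.1}

theorem eventually_windows_iff {P : ℕ × ℕ × ℝ → Prop} :
    (∀ᶠ w in windows m F, P w) ↔
      ∀ᶠ q in F, ∀ k ∈ Finset.Icc (m q.1) q.1, P (k, q) := by
  rw [windows, eventually_inf_principal, eventually_comap]
  exact eventually_congr (Eventually.of_forall fun q =>
    ⟨fun hP k hk => hP (k, q) rfl hk, fun hP w hw hk => by subst hw; exact hP w.1 hk⟩)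

theorem windows_mono (hFG : F ≤ G) : windows m F ≤ windows m G :=
  inf_le_inf_right _ (comap_mono hFG)

theorem eventually_mem_windows : ∀ᶠ w in windows m F, w.1 ∈ Finset.Icc (m w.2.1) w.2.1 :=
  mem_inf_of_right (mem_principal_self _)

theorem tendsto_snd_windows : Tendsto Prod.snd (windows m F) F :=
  tendsto_comap.mono_left inf_le_left

theorem tendsto_right_end_windows (hmn : ∀ n, m n ≤ n) :
    Tendsto (fun w : ℕ × ℕ × ℝ => (w.2.1, w.2)) (windows m F) (windows m F) :=
  tendsto_inf.2 ⟨tendsto_comap_iff.2 tendsto_snd_windows, tendsto_principal.2 <|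
    Eventually.of_forall fun w => Finset.right_mem_Icc.2 (hmn w.2.1)⟩

theorem tendsto_windows_scalesAbove {V : Type*} [NormedAddCommGroup V] {x : ℕ → V}
    (hm : Tendsto m atTop atTop) :
    Tendsto (fun w : ℕ × ℕ × ℝ => (w.1, w.2.2)) (windows m (scalesAbove x)) (scalesAbove x) := by
  have hstart : Tendsto (fun w : ℕ × ℕ × ℝ => m w.2.1) (windows m (scalesAbove x)) atTop :=
    hm.comp (tendsto_fst_scalesAbove.comp tendsto_snd_windows)
  have htime : Tendsto Prod.fst (windows m (scalesAbove x)) atTop :=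
    tendsto_atTop_mono' _ (eventually_mem_windows.mono fun w hw => (Finset.mem_Icc.1 hw).1) hstart
  refine tendsto_inf.2 ⟨?_, tendsto_principal.2 ?_⟩
  · rw [← prod_atTop_atTop_eq]
    exact htime.prodMk (tendsto_snd_scalesAbove.comp tendsto_snd_windows)
  · filter_upwards [eventually_mem_windows,
      tendsto_snd_windows.eventually eventually_runningBound_le] with w hw hR
    exact ((runningBound x).monotone (Finset.mem_Icc.1 hw).2).trans hR

end Windows

section Scheme

variable {N : ℕ} {d : Fin N → ℕ} {h : (j : Fin N) → NState d → EuclideanSpace ℝ (Fin (d j))}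
  {α : Fin N → ℕ → ℝ} {x : ℕ → NState d} {m : ℕ → ℕ} {F : Filter (ℕ × ℝ)}

/-- The increments of `x` agree with those of the noiseless scheme `x + α • h x` up to an error
that is asymptotically negligible relative to the running maximum of `x`. -/
def IsAsymptoticEuler (h : (j : Fin N) → NState d → EuclideanSpace ℝ (Fin (d j)))
    (α : Fin N → ℕ → ℝ) (x : ℕ → NState d) : Prop :=
  ∀ j, ∀ ε > 0, ∀ᶠ a in atTop, ∀ b ≥ a,
    ‖x b j - x a j - ∑ k ∈ Finset.Ico a b, α j k • h j (x k)‖ ≤ ε * runningBound x b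

/-- On the `i`-th timescale, the rescaled iterates approach the graph of `lam i` over the slower
components. -/
def TracksGraph (lam : (i : Fin N) → NAbove d i → EuclideanSpace ℝ (Fin (d i)))
    (x : ℕ → NState d) (i : Fin N) : Prop :=
  Tendsto (fun q => rescaled x q i - lam i (aboveOf i (rescaled x q))) (scalesAbove x) (𝓝 0)

theorem IsAsymptoticEuler.tendsto_windows (hx : IsAsymptoticEuler h α x)
    (hm : Tendsto m atTop atTop) (j : Fin N) :
    Tendsto (fun w : ℕ × ℕ × ℝ => rescaled x (w.1, w.2.2) j - rescaled x (m w.2.1, w.2.2) j -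
        ∑ l ∈ Finset.Ico (m w.2.1) w.1, α j l • rescaled (fun k => h j (x k)) (l, w.2.2))
      (windows m (scalesAbove x)) (𝓝 0) := by
  refine Metric.tendsto_nhds.2 fun ε hε => ?_
  have hstart := (hm.comp ((tendsto_fst_scalesAbove (x := x)).comp
    (tendsto_snd_windows (m := m)))).eventually (hx j (ε / 2) (half_pos hε))
  filter_upwards [hstart, eventually_mem_windows,
    (tendsto_windows_scalesAbove hm).eventually eventually_runningBound_le] with
    ⟨k, n, ρ⟩ herr hk hR
  have hρ : 0 < ρ := (runningBound_pos k).trans_le hR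
  have hfactor : rescaled x (k, ρ) j - rescaled x (m n, ρ) j -
        ∑ l ∈ Finset.Ico (m n) k, α j l • rescaled (fun k => h j (x k)) (l, ρ)
      = ρ⁻¹ • (x k j - x (m n) j - ∑ l ∈ Finset.Ico (m n) k, α j l • h j (x l)) := by
    simp only [rescaled, Pi.smul_apply, smul_sub, Finset.smul_sum, smul_comm ρ⁻¹]
  rw [dist_zero_right, hfactor, norm_smul_of_nonneg (inv_nonneg.2 hρ.le), inv_mul_lt_iff₀ hρ]
  calc _ ≤ ε / 2 * runningBound x k := herr k (Finset.mem_Icc.1 hk).1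
    _ ≤ ε / 2 * ρ := by gcongr
    _ < ρ * ε := by nlinarith

theorem IsAsymptoticEuler.tendsto_slow (hx : IsAsymptoticEuler h α x)
    {j : Fin N} (hh : ∃ C : ℝ≥0, LipschitzWith C (h j)) (hm : Tendsto m atTop atTop)
    (hα : ∀ n, 0 ≤ α j n)
    (hsum : Tendsto (fun n => ∑ k ∈ Finset.Ico (m n) n, α j k) atTop (𝓝 0)) :
    Tendsto (fun w : ℕ × ℕ × ℝ => rescaled x (w.1, w.2.2) j - rescaled x (m w.2.1, w.2.2) j)
      (windows m (scalesAbove x)) (𝓝 0) := by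
  obtain ⟨C, hC⟩ := hh
  have hdrift : Tendsto (fun w : ℕ × ℕ × ℝ =>
      ∑ l ∈ Finset.Ico (m w.2.1) w.1, α j l • rescaled (fun k => h j (x k)) (l, w.2.2))
      (windows m (scalesAbove x)) (𝓝 0) := by
    have hlim := ((hsum.comp (tendsto_fst_scalesAbove (x := x))).comp
      (tendsto_snd_windows (m := m))).mul_const (C + ‖h j 0‖)
    rw [zero_mul] at hlim
    refine squeeze_zero_norm' ?_ hlim
    filter_upwards [eventually_mem_windows,
      tendsto_snd_windows.eventually eventually_runningBound_le] with ⟨k, n, ρ⟩ hk hR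
    have hkn : k ≤ n := (Finset.mem_Icc.1 hk).2
    calc ‖∑ l ∈ Finset.Ico (m n) k, α j l • rescaled (fun k => h j (x k)) (l, ρ)‖
        ≤ ∑ l ∈ Finset.Ico (m n) k, α j l * (C + ‖h j 0‖) := by
          refine norm_sum_le_of_le _ fun l hl => ?_
          have hln : l ≤ n := (Finset.mem_Ico.1 hl).2.le.trans hkn
          rw [norm_smul_of_nonneg (hα l)]
          gcongr
          · exact hα l
          · exact norm_rescaled_comp_le hC (((runningBound x).monotone hln).trans hR)
      _ ≤ ∑ l ∈ Finset.Ico (m n) n, α j l * (C + ‖h j 0‖) :=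
          Finset.sum_le_sum_of_subset_of_nonneg (Finset.Ico_subset_Ico_right hkn)
            fun l _ _ => mul_nonneg (hα l) (by positivity)
      _ = _ := (Finset.sum_mul ..).symm
  simpa using (hx.tendsto_windows hm j).add hdrift

theorem IsAsymptoticEuler.tendsto_aboveOf_sub (hx : IsAsymptoticEuler h α x)
    (hh : ∀ j, ∃ C : ℝ≥0, LipschitzWith C (h j)) (hα : IsStepSizes α)
    (hm : Tendsto m atTop atTop) (hmn : ∀ n, m n ≤ n) {i : Fin N} {B : ℝ}
    (hB : ∀ᶠ n in atTop, ∑ k ∈ Finset.Ico (m n) n, α i k ≤ B) :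
    Tendsto (fun w : ℕ × ℕ × ℝ =>
        aboveOf i (rescaled x (w.1, w.2.2)) - aboveOf i (rescaled x w.2))
      (windows m (scalesAbove x)) (𝓝 0) := by
  refine tendsto_pi_nhds.2 fun ⟨l, hil⟩ => ?_
  have hsum := tendsto_sum_Ico_zero_of_tendsto_div_zero (hα.pos i) (fun n => (hα.pos l n).le)
    (hα.tendsto_ratio hil) hm hB
  have hslow := hx.tendsto_slow (hh l) hm (fun n => (hα.pos l n).le) hsum
  simpa using hslow.sub (hslow.comp (tendsto_right_end_windows hmn))

variable {hInf : (i : Fin N) → NFrom d i → EuclideanSpace ℝ (Fin (d i))}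
  {lam : (i : Fin N) → NAbove d i → EuclideanSpace ℝ (Fin (d i))} {i : Fin N}

theorem ScaledCondition.tendsto_rescaled_drift (hB : ScaledCondition h hInf lam i)
    (hh : ∃ C : ℝ≥0, LipschitzWith C (h i)) (hlam : ∀ j, ∃ C : ℝ≥0, LipschitzWith C (lam j))
    (htrack : ∀ j < i, TracksGraph lam x j) :
    Tendsto (fun q => rescaled (fun k => h i (x k)) q - hInf i (fromOf i (rescaled x q)))
      (scalesAbove x) (𝓝 0) := by
  obtain ⟨C, hC⟩ := hh
  have hfast : Tendsto (fun q => rescaled (fun k => h i (x k)) q -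
      scaledDrift h lam i q.2 (fromOf i (rescaled x q))) (scalesAbove x) (𝓝 0) := by
    have hlim := (tendsto_sub_cascade_zero hlam htrack).norm.const_mul (C : ℝ)
    rw [norm_zero, mul_zero] at hlim
    refine squeeze_zero_norm' ?_ hlim
    filter_upwards [eventually_runningBound_le] with q hq
    have hpos : 0 < q.2 := (runningBound_pos _).trans_le hq
    simpa only [rescaled, smul_inv_smul₀ hpos.ne'] using
      norm_inv_smul_sub_scaledDrift_le (lam := lam) hC hpos (fromOf i (rescaled x q)) (rescaled x q)
  have hscale : Tendsto (fun q => scaledDrift h lam i q.2 (fromOf i (rescaled x q)) -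
      hInf i (fromOf i (rescaled x q))) (scalesAbove x) (𝓝 0) := by
    refine Metric.tendsto_nhds.2 fun ε hε => ?_
    have hunif := Metric.tendstoUniformlyOn_iff.1
      (hB.limit _ (isCompact_closedBall (0 : NFrom d i) 1)) ε hε
    filter_upwards [tendsto_snd_scalesAbove.eventually hunif, eventually_runningBound_le]
      with q hq hR
    have hmem : fromOf i (rescaled x q) ∈ Metric.closedBall (0 : NFrom d i) 1 := by
      rw [mem_closedBall_zero_iff, pi_norm_le_iff_of_nonneg zero_le_one]
      exact fun l => (norm_le_pi_norm _ l.1).trans (norm_rescaled_le_one hR)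
    rw [dist_zero_right, ← dist_eq_norm, dist_comm]
    exact hq _ hmem
  simpa using hfast.add hscale

theorem tendsto_drift_sub_frozen {hInf : NFrom d i → EuclideanSpace ℝ (Fin (d i))}
    (hInf_lip : ∃ C : ℝ≥0, LipschitzWith C hInf)
    (hdrift : Tendsto (fun q => rescaled (fun k => h i (x k)) q - hInf (fromOf i (rescaled x q)))
      (scalesAbove x) (𝓝 0))
    (hm : Tendsto m atTop atTop)
    (hslow : Tendsto (fun w : ℕ × ℕ × ℝ =>
        aboveOf i (rescaled x (w.1, w.2.2)) - aboveOf i (rescaled x w.2))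
      (windows m (scalesAbove x)) (𝓝 0))
    (hF : F ≤ scalesAbove x) {p : NAbove d i}
    (hp : Tendsto (fun q => aboveOf i (rescaled x q)) F (𝓝 p)) :
    Tendsto (fun w : ℕ × ℕ × ℝ => rescaled (fun k => h i (x k)) (w.1, w.2.2) -
        hInf (NFrom.cons i (rescaled x (w.1, w.2.2) i) p)) (windows m F) (𝓝 0) := by
  obtain ⟨C, hC⟩ := hInf_lip
  have hcons : Tendsto (fun w : ℕ × ℕ × ℝ => fromOf i (rescaled x (w.1, w.2.2)) -
      NFrom.cons i (rescaled x (w.1, w.2.2) i) p) (windows m F) (𝓝 0) := by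
    have habove : Tendsto (fun w : ℕ × ℕ × ℝ => aboveOf i (rescaled x (w.1, w.2.2)) - p)
        (windows m F) (𝓝 0) := by
      simpa using (hslow.mono_left (windows_mono hF)).add
        ((hp.comp tendsto_snd_windows).sub_const p)
    refine squeeze_zero_norm (fun w => ?_) (by simpa using habove.norm)
    rw [← NFrom.cons_aboveOf]
    simpa using NFrom.norm_cons_sub_cons_le i (rescaled x (w.1, w.2.2) i)
      (rescaled x (w.1, w.2.2) i) (aboveOf i (rescaled x (w.1, w.2.2))) p
  simpa using ((hdrift.comp (tendsto_windows_scalesAbove hm)).mono_left (windows_mono hF)).add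
    (tendsto_sub_zero_of_lipschitzWith hC hcons)

end Scheme

section Tracking

variable {N : ℕ} {d : Fin N → ℕ} {h : (j : Fin N) → NState d → EuclideanSpace ℝ (Fin (d j))}
  {α : Fin N → ℕ → ℝ} {x : ℕ → NState d} {m : ℕ → ℕ} {F : Filter (ℕ × ℝ)} {i : Fin N}

theorem IsAsymptoticEuler.eventually_isApproxEuler (hx : IsAsymptoticEuler h α x)
    (hm : Tendsto m atTop atTop) (hα : ∀ n, 0 ≤ α i n) (hα0 : Tendsto (α i) atTop (𝓝 0)) {B : ℝ}
    (hB : ∀ᶠ n in atTop, ∑ k ∈ Finset.Ico (m n) n, α i k ≤ B) (hF : F ≤ scalesAbove x)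
    {f : EuclideanSpace ℝ (Fin (d i)) → EuclideanSpace ℝ (Fin (d i))}
    (hf : Tendsto (fun w : ℕ × ℕ × ℝ => rescaled (fun k => h i (x k)) (w.1, w.2.2) -
      f (rescaled x (w.1, w.2.2) i)) (windows m F) (𝓝 0)) {ε : ℝ} (hε : 0 < ε) :
    ∀ᶠ q in F, IsApproxEuler f ε (α i) (fun k => rescaled x (k, q.2) i) (m q.1) q.1 := by
  have htime : Tendsto Prod.fst F atTop := tendsto_fst_scalesAbove.mono_left hF
  have hstep : ∀ᶠ q in F, ∀ k ≥ m q.1, α i k ≤ ε :=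
    (hm.comp htime).eventually (eventually_forall_ge_atTop.2 (hα0.eventually_le_const hε))
  have hEuler := eventually_windows_iff.1 <| (tendsto_zero_iff_norm_tendsto_zero.1 <|
    (hx.tendsto_windows hm i).mono_left (windows_mono hF)).eventually_le_const (half_pos hε)
  have hdrift := eventually_windows_iff.1 <|
    (tendsto_zero_iff_norm_tendsto_zero.1 hf).eventually_le_const
      (show 0 < ε / 2 / (1 + |B|) by positivity)
  filter_upwards [hstep, hEuler, hdrift, htime.eventually hB] with ⟨n, ρ⟩ hstep hEuler hdrift hB
  refine ⟨fun k _ => hα k, fun k hk => hstep k (Finset.mem_Ico.1 hk).1, fun k hk => ?_⟩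
  have hkn : k ≤ n := (Finset.mem_Icc.1 hk).2
  have hfrozen : ‖∑ l ∈ Finset.Ico (m n) k, α i l •
      (rescaled (fun k => h i (x k)) (l, ρ) - f (rescaled x (l, ρ) i))‖ ≤ ε / 2 :=
    calc _ ≤ ∑ l ∈ Finset.Ico (m n) k, α i l * (ε / 2 / (1 + |B|)) := by
          refine norm_sum_le_of_le _ fun l hl => ?_
          rw [norm_smul_of_nonneg (hα l)]
          gcongr
          · exact hα l
          · exact hdrift l (Finset.Ico_subset_Icc_self (Finset.Ico_subset_Ico_right hkn hl))
      _ ≤ (1 + |B|) * (ε / 2 / (1 + |B|)) := by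
          rw [← Finset.sum_mul]
          gcongr
          calc _ ≤ ∑ l ∈ Finset.Ico (m n) n, α i l := Finset.sum_le_sum_of_subset_of_nonneg
                (Finset.Ico_subset_Ico_right hkn) fun l _ _ => hα l
            _ ≤ 1 + |B| := by linarith [le_abs_self B]
      _ = ε / 2 := by field_simp
  calc _ = ‖(rescaled x (k, ρ) i - rescaled x (m n, ρ) i - ∑ l ∈ Finset.Ico (m n) k,
          α i l • rescaled (fun k => h i (x k)) (l, ρ)) + ∑ l ∈ Finset.Ico (m n) k, α i l •
          (rescaled (fun k => h i (x k)) (l, ρ) - f (rescaled x (l, ρ) i))‖ := by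
        simp only [smul_sub, Finset.sum_sub_distrib, sub_add_sub_cancel]
    _ ≤ ε / 2 + ε / 2 := norm_add_le_of_le (hEuler k hk) hfrozen
    _ = ε := add_halves ε

variable {hInf : (i : Fin N) → NFrom d i → EuclideanSpace ℝ (Fin (d i))}
  {lam : (i : Fin N) → NAbove d i → EuclideanSpace ℝ (Fin (d i))}

theorem IsAsymptoticEuler.tendsto_lam (hx : IsAsymptoticEuler h α x) (hα : IsStepSizes α)
    (hh : ∀ j, ∃ C : ℝ≥0, LipschitzWith C (h j)) (hB : ∀ j, ScaledCondition h hInf lam j)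
    (htrack : ∀ j < i, TracksGraph lam x j) (hF : F ≤ scalesAbove x) {p : NAbove d i}
    (hp : Tendsto (fun q => aboveOf i (rescaled x q)) F (𝓝 p)) :
    Tendsto (fun q => rescaled x q i) F (𝓝 (lam i p)) := by
  have hlam : ∀ j, ∃ C : ℝ≥0, LipschitzWith C (lam j) := fun j => (hB j).lipschitz
  obtain ⟨C, hC⟩ := (hB i).exists_lipschitzWith (hh i) hlam
  refine Metric.tendsto_nhds.2 fun δ hδ => ?_
  obtain ⟨T, hT, ε, hε, htracking⟩ := ((hB i).gas p).exists_isApproxEuler_tracking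
    (hC.comp (NFrom.lipschitzWith_cons i p)) 1 (half_pos hδ)
  obtain ⟨m, hm, hmn, hwindow⟩ :=
    exists_tendsto_atTop_sum_Ico_mem_Icc (hα.sum_eq_top i) (hα.tendsto_zero i) hT
  have hle := hwindow.mono fun n hn => hn.2
  have hfrozen := tendsto_drift_sub_frozen ⟨C, hC⟩
    ((hB i).tendsto_rescaled_drift (hh i) hlam htrack) hm
    (hx.tendsto_aboveOf_sub hh hα hm hmn hle) hF hp
  have hstart : ∀ᶠ q in F, ‖rescaled x (m q.1, q.2)‖ ≤ 1 :=
    (eventually_runningBound_le.filter_mono hF).mono fun q hq =>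
      norm_rescaled_le_one (((runningBound x).monotone (hmn q.1)).trans hq)
  have hEuler := hx.eventually_isApproxEuler hm (fun n => (hα.pos i n).le) (hα.tendsto_zero i)
    hle hF (f := fun u => hInf i (NFrom.cons i u p)) hfrozen hε
  filter_upwards [hEuler, hstart, (tendsto_fst_scalesAbove.mono_left hF).eventually hwindow]
    with ⟨n, ρ⟩ hEuler hone hsum
  have hstart_i : ‖rescaled x (m n, ρ) i‖ ≤ 1 := (norm_le_pi_norm _ i).trans hone
  rw [dist_eq_norm]
  exact (htracking _ _ _ _ (hmn n) hEuler hsum hstart_i).trans_lt (half_lt_self hδ)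

theorem IsAsymptoticEuler.tracksGraph (hx : IsAsymptoticEuler h α x) (hα : IsStepSizes α)
    (hh : ∀ j, ∃ C : ℝ≥0, LipschitzWith C (h j)) (hB : ∀ j, ScaledCondition h hInf lam j)
    (i : Fin N) : TracksGraph lam x i := by
  induction i using WellFoundedLT.induction with
  | ind i ih =>
    refine tendsto_iff_ultrafilter _ _ _ |>.2 fun U hU => ?_
    have hball : ∀ᶠ q in (U : Filter (ℕ × ℝ)),
        aboveOf i (rescaled x q) ∈ Metric.closedBall 0 1 := by
      filter_upwards [eventually_runningBound_le.filter_mono hU] with q hq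
      rw [mem_closedBall_zero_iff, pi_norm_le_iff_of_nonneg zero_le_one]
      exact fun l => (norm_le_pi_norm _ l.1).trans (norm_rescaled_le_one hq)
    obtain ⟨p, -, hp⟩ := (isCompact_closedBall (0 : NAbove d i) 1).ultrafilter_le_nhds
      (U.map fun q => aboveOf i (rescaled x q)) (le_principal_iff.2 hball)
    obtain ⟨C, hC⟩ := (hB i).lipschitz
    simpa using (hx.tendsto_lam hα hh hB ih hU hp).sub ((hC.continuous.tendsto p).comp hp)

theorem IsAsymptoticEuler.bddAbove_norm (hx : IsAsymptoticEuler h α x) (hα : IsStepSizes α)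
    (hh : ∀ j, ∃ C : ℝ≥0, LipschitzWith C (h j)) (hB : ∀ j, ScaledCondition h hInf lam j) :
    BddAbove (Set.range fun n => ‖x n‖) :=
  bddAbove_norm_of_tendsto_rescaled <| tendsto_zero_of_tendsto_sub_map_aboveOf
    (fun j => (hB j).lipschitz) (fun j => (hB j).map_zero) (hx.tracksGraph hα hh hB)

end Tracking

section MartingaleDifferences

variable {Ω : Type*} {m₀ : MeasurableSpace Ω} {μ : Measure Ω}

theorem lintegral_mul_condLExp {m : MeasurableSpace Ω} (hm : m ≤ m₀) [SigmaFinite (μ.trim hm)]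
    {w X : Ω → ℝ≥0∞} (hw : Measurable[m] w) (hX : Measurable[m₀] X) :
    ∫⁻ ω, w ω * condLExp m μ X ω ∂μ = ∫⁻ ω, w ω * X ω ∂μ := by
  have htrim : (μ.withDensity (condLExp m μ X)).trim hm = (μ.withDensity X).trim hm := by
    refine @Measure.ext _ m _ _ fun s hs => ?_
    rw [trim_measurableSet_eq hm hs, trim_measurableSet_eq hm hs, withDensity_apply _ (hm s hs),
      withDensity_apply _ (hm s hs), setLIntegral_condLExp hm μ X hs]
  have hdensity {Y : Ω → ℝ≥0∞} (hY : Measurable[m₀] Y) :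
      ∫⁻ ω, w ω * Y ω ∂μ = ∫⁻ ω, w ω ∂((μ.withDensity Y).trim hm) := by
    rw [lintegral_trim hm hw, lintegral_withDensity_eq_lintegral_mul μ hY (hw.mono hm le_rfl)]
    simp only [Pi.mul_apply, mul_comm]
  rw [hdensity (measurable_condLExp' m μ X), hdensity hX, htrim]

section InnerProductSpace

variable {E : Type*} [NormedAddCommGroup E] [InnerProductSpace ℝ E]

theorem integrable_inner_of_memLp_two {f g : Ω → E} (hf : MemLp f 2 μ) (hg : MemLp g 2 μ) :
    Integrable (fun ω => inner ℝ (f ω) (g ω)) μ :=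
  (hf.norm.integrable_mul hg.norm).mono' (hf.1.inner hg.1)
    (Eventually.of_forall fun _ => norm_inner_le_norm _ _)

variable [CompleteSpace E] [IsFiniteMeasure μ]

theorem integral_inner_eq_zero_of_condExp_eq_zero {m : MeasurableSpace Ω} (hm : m ≤ m₀)
    {f g : Ω → E} (hf : StronglyMeasurable[m] f) (hf2 : MemLp f 2 μ) (hg2 : MemLp g 2 μ)
    (hg : μ[g | m] =ᵐ[μ] 0) : ∫ ω, inner ℝ (f ω) (g ω) ∂μ = 0 := by
  rw [← integral_condExp hm]
  refine integral_eq_zero_of_ae ?_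
  filter_upwards [condExp_bilin_of_stronglyMeasurable_left (innerSL ℝ) hf
    (integrable_inner_of_memLp_two hf2 hg2) (hg2.integrable one_le_two), hg] with ω hpull hω
  exact hpull.trans (by simp [hω])

theorem integral_norm_sum_sq_eq {ℱ : Filtration ℕ m₀} {ξ : ℕ → Ω → E}
    (hmeas : ∀ n, StronglyMeasurable[ℱ (n + 1)] (ξ n)) (hL2 : ∀ n, MemLp (ξ n) 2 μ)
    (hcond : ∀ n, μ[ξ n | ℱ n] =ᵐ[μ] 0) (n : ℕ) :
    ∫ ω, ‖∑ k ∈ Finset.range n, ξ k ω‖ ^ 2 ∂μ = ∑ k ∈ Finset.range n, ∫ ω, ‖ξ k ω‖ ^ 2 ∂μ := by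
  induction n with
  | zero => simp
  | succ n ih =>
    have hSmeas : StronglyMeasurable[ℱ n] fun ω => ∑ k ∈ Finset.range n, ξ k ω :=
      Finset.stronglyMeasurable_fun_sum _ fun k hk =>
        (hmeas k).mono (ℱ.mono (Finset.mem_range.1 hk))
    have hS2 : MemLp (fun ω => ∑ k ∈ Finset.range n, ξ k ω) 2 μ :=
      memLp_finsetSum _ fun k _ => hL2 k
    have hcross := integral_inner_eq_zero_of_condExp_eq_zero (ℱ.le n) hSmeas hS2 (hL2 n) (hcond n)
    have hinner := integrable_inner_of_memLp_two hS2 (hL2 n)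
    have hS := (memLp_two_iff_integrable_sq_norm hS2.1).1 hS2
    have hξ := (memLp_two_iff_integrable_sq_norm (hL2 n).1).1 (hL2 n)
    simp only [Finset.sum_range_succ, norm_add_sq_real]
    rw [integral_add (hS.fun_add (hinner.const_mul 2)) hξ, integral_add hS (hinner.const_mul 2),
      integral_const_mul, hcross, ih, mul_zero, add_zero]

end InnerProductSpace

variable {ℱ : Filtration ℕ m₀} [IsFiniteMeasure μ]

theorem ae_exists_tendsto_sum_real_of_condExp_eq_zero {ξ : ℕ → Ω → ℝ}
    (hmeas : ∀ n, StronglyMeasurable[ℱ (n + 1)] (ξ n)) (hL2 : ∀ n, MemLp (ξ n) 2 μ)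
    (hcond : ∀ n, μ[ξ n | ℱ n] =ᵐ[μ] 0) (hsum : Summable fun n => ∫ ω, ‖ξ n ω‖ ^ 2 ∂μ) :
    ∀ᵐ ω ∂μ, ∃ l, Tendsto (fun n => ∑ k ∈ Finset.range n, ξ k ω) atTop (𝓝 l) := by
  set S : ℕ → Ω → ℝ := fun n ω => ∑ k ∈ Finset.range n, ξ k ω with hS
  have hS2 : ∀ n, MemLp (S n) 2 μ := fun n => memLp_finsetSum _ fun k _ => hL2 k
  have hmart : Martingale S ℱ μ := by
    refine martingale_of_condExp_sub_eq_zero_nat (fun n => ?_)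
      (fun n => (hS2 n).integrable one_le_two) fun n => ?_
    · exact Finset.stronglyMeasurable_fun_sum _ fun k hk =>
        (hmeas k).mono (ℱ.mono (Finset.mem_range.1 hk))
    · have hincr : S (n + 1) - S n = ξ n := by
        funext ω
        simp [hS, Finset.sum_range_succ]
      rw [hincr]
      exact hcond n
  have hsecond : ∀ n, ∫ ω, ‖S n ω‖ ^ 2 ∂μ ≤ ∑' n, ∫ ω, ‖ξ n ω‖ ^ 2 ∂μ := fun n => by
    rw [integral_norm_sum_sq_eq hmeas hL2 hcond]
    exact hsum.sum_le_tsum _ fun k _ => by positivity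
  refine hmart.submartingale.exists_ae_tendsto_of_bdd
    (R := (μ.real Set.univ + ∑' n, ∫ ω, ‖ξ n ω‖ ^ 2 ∂μ).toNNReal) fun n => ?_
  have hsq := (memLp_two_iff_integrable_sq_norm (hS2 n).1).1 (hS2 n)
  have hone : Integrable (fun _ : Ω => (1 : ℝ)) μ := integrable_const 1
  rw [eLpNorm_one_eq_lintegral_enorm, ← ofReal_integral_norm_eq_lintegral_enorm
    ((hS2 n).integrable one_le_two)]
  refine ENNReal.ofReal_le_ofReal ?_
  calc ∫ ω, ‖S n ω‖ ∂μ ≤ ∫ ω, (1 + ‖S n ω‖ ^ 2) ∂μ :=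
        integral_mono ((hS2 n).integrable one_le_two).norm (hone.add hsq) fun ω => by
          nlinarith [sq_nonneg (‖S n ω‖ - 1)]
    _ ≤ _ := by
        rw [integral_add hone hsq]
        simpa using hsecond n

theorem ae_exists_tendsto_sum_of_condExp_eq_zero {ι : Type*} [Fintype ι]
    {ξ : ℕ → Ω → EuclideanSpace ℝ ι} (hmeas : ∀ n, StronglyMeasurable[ℱ (n + 1)] (ξ n))
    (hL2 : ∀ n, MemLp (ξ n) 2 μ) (hcond : ∀ n, μ[ξ n | ℱ n] =ᵐ[μ] 0)
    (hsum : Summable fun n => ∫ ω, ‖ξ n ω‖ ^ 2 ∂μ) :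
    ∀ᵐ ω ∂μ, ∃ l, Tendsto (fun n => ∑ k ∈ Finset.range n, ξ k ω) atTop (𝓝 l) := by
  have hcoord : ∀ i, ∀ᵐ ω ∂μ, ∃ l,
      Tendsto (fun n => ∑ k ∈ Finset.range n, ξ k ω i) atTop (𝓝 l) := fun i => by
    let π : EuclideanSpace ℝ ι →L[ℝ] ℝ := EuclideanSpace.proj i
    have hπ2 : ∀ n, MemLp (fun ω => ξ n ω i) 2 μ := fun n => π.comp_memLp' (hL2 n)
    refine ae_exists_tendsto_sum_real_of_condExp_eq_zero
      (fun n => π.continuous.comp_stronglyMeasurable (hmeas n)) hπ2 (fun n => ?_)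
      (hsum.of_nonneg_of_le (fun n => by positivity) fun n => ?_)
    · filter_upwards [π.comp_condExp_comm (m := ℱ n) ((hL2 n).integrable one_le_two), hcond n]
        with ω hπ hω
      exact hπ.symm.trans (by simp [hω])
    · refine integral_mono ((memLp_two_iff_integrable_sq_norm (hπ2 n).1).1 (hπ2 n))
        ((memLp_two_iff_integrable_sq_norm (hL2 n).1).1 (hL2 n)) fun ω => ?_
      exact pow_le_pow_left₀ (norm_nonneg _) (PiLp.norm_apply_le _ i) 2
  filter_upwards [ae_all_iff.2 hcoord] with ω hω
  choose l hl using hω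
  have hlim : Tendsto (fun n i => ∑ k ∈ Finset.range n, ξ k ω i) atTop (𝓝 l) :=
    tendsto_pi_nhds.2 hl
  refine ⟨WithLp.toLp 2 l, (((PiLp.continuous_toLp 2 _).tendsto l).comp hlim).congr fun n => ?_⟩
  ext i
  simp

end MartingaleDifferences

section AbelSummation

variable {E : Type*} [NormedAddCommGroup E] [NormedSpace ℝ E] {R : ℕ → ℝ} {v : ℕ → E} {ε : ℝ}
  {a b : ℕ}

theorem norm_sum_smul_sub_smul_sum_le (hR : Monotone R) (hab : a ≤ b)
    (hv : ∀ k ∈ Finset.Icc a b, ‖∑ i ∈ Finset.Ico k b, v i‖ ≤ ε) :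
    ‖∑ k ∈ Finset.Ico a b, R k • v k - R a • ∑ k ∈ Finset.Ico a b, v k‖ ≤ ε * (R b - R a) := by
  induction hab using Nat.decreasingInduction with
  | self => simp
  | of_succ k hk ih =>
    have hincr : 0 ≤ R (k + 1) - R k := sub_nonneg.2 (hR k.le_succ)
    have htail : ‖∑ i ∈ Finset.Ico (k + 1) b, v i‖ ≤ ε :=
      hv (k + 1) (Finset.mem_Icc.2 ⟨k.le_succ, hk⟩)
    have hsplit : ∑ i ∈ Finset.Ico k b, R i • v i - R k • ∑ i ∈ Finset.Ico k b, v i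
        = (∑ i ∈ Finset.Ico (k + 1) b, R i • v i
            - R (k + 1) • ∑ i ∈ Finset.Ico (k + 1) b, v i)
          + (R (k + 1) - R k) • ∑ i ∈ Finset.Ico (k + 1) b, v i := by
      rw [Finset.sum_eq_sum_Ico_succ_bot hk, Finset.sum_eq_sum_Ico_succ_bot hk]
      module
    rw [hsplit]
    calc _ ≤ ε * (R b - R (k + 1)) + (R (k + 1) - R k) * ε := by
          refine norm_add_le_of_le
            (ih fun i hi => hv i (Finset.Icc_subset_Icc_left k.le_succ hi)) ?_
          rw [norm_smul_of_nonneg hincr]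
          gcongr
      _ = ε * (R b - R k) := by ring

theorem norm_sum_Ico_smul_le_of_monotone (hR : Monotone R) (hRa : 0 ≤ R a) (hab : a ≤ b)
    (hv : ∀ k ∈ Finset.Icc a b, ‖∑ i ∈ Finset.Ico k b, v i‖ ≤ ε) :
    ‖∑ k ∈ Finset.Ico a b, R k • v k‖ ≤ ε * R b :=
  calc _ = ‖(∑ k ∈ Finset.Ico a b, R k • v k - R a • ∑ k ∈ Finset.Ico a b, v k)
        + R a • ∑ k ∈ Finset.Ico a b, v k‖ := by rw [sub_add_cancel]
    _ ≤ ε * (R b - R a) + R a * ε := by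
        refine norm_add_le_of_le (norm_sum_smul_sub_smul_sum_le hR hab hv) ?_
        rw [norm_smul_of_nonneg hRa]
        gcongr
        exact hv a (Finset.left_mem_Icc.2 hab)
    _ = ε * R b := by ring

end AbelSummation

section Noise

variable {N : ℕ} {d : Fin N → ℕ}

theorem isAsymptoticEuler_of_tendsto_sum {h : (j : Fin N) → NState d → EuclideanSpace ℝ (Fin (d j))}
    {α : Fin N → ℕ → ℝ} {x V : ℕ → NState d}
    (hrec : ∀ n j, x (n + 1) j = x n j + α j n • (h j (x n) + V n j))
    (hV : ∀ j, ∃ l, Tendsto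
      (fun n => ∑ k ∈ Finset.range n, α j k • (runningBound x k)⁻¹ • V k j) atTop (𝓝 l)) :
    IsAsymptoticEuler h α x := by
  intro j ε hε
  obtain ⟨l, hl⟩ := hV j
  obtain ⟨n₀, hn₀⟩ := Metric.cauchySeq_iff.1 hl.cauchySeq ε hε
  filter_upwards [eventually_ge_atTop n₀] with a ha b hab
  have hnoise : x b j - x a j - ∑ k ∈ Finset.Ico a b, α j k • h j (x k) =
      ∑ k ∈ Finset.Ico a b, runningBound x k • α j k • (runningBound x k)⁻¹ • V k j := by
    rw [← Finset.sum_Ico_sub (fun k => x k j) hab, ← Finset.sum_sub_distrib]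
    refine Finset.sum_congr rfl fun k _ => ?_
    rw [smul_comm (runningBound x k), smul_inv_smul₀ (runningBound_pos k).ne', hrec]
    module
  rw [hnoise]
  refine norm_sum_Ico_smul_le_of_monotone (runningBound x).monotone (runningBound_pos a).le hab
    fun k hk => ?_
  obtain ⟨hak, hkb⟩ := Finset.mem_Icc.1 hk
  rw [Finset.sum_Ico_eq_sub _ hkb, ← dist_eq_norm]
  exact (hn₀ b (ha.trans hab) k (ha.trans hak)).le

variable {Ω : Type*} {x M : ℕ → Ω → NState d}

theorem history_mono : Monotone (history x M) := fun _ _ hmn =>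
  sup_le_sup (iSup_mono fun _ => iSup_mono' fun hi => ⟨hi.trans hmn, le_rfl⟩)
    (iSup_mono fun _ => iSup_mono' fun hi => ⟨⟨hi.1, hi.2.trans hmn⟩, le_rfl⟩)

theorem measurable_history_state {i n : ℕ} (hi : i ≤ n) : Measurable[history x M n] (x i) := by
  let _ := history x M n
  refine measurable_pi_iff.2 fun j => Measurable.of_comap_le (le_trans ?_ le_sup_left)
  exact le_iSup_of_le i (le_iSup_of_le hi (le_iSup_of_le j le_rfl))

theorem measurable_history_noise (n : ℕ) (j : Fin N) :
    Measurable[history x M (n + 1)] fun ω => M (n + 1) ω j := by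
  refine Measurable.of_comap_le (le_trans ?_ le_sup_right)
  exact le_iSup_of_le (n + 1) (le_iSup_of_le ⟨n.succ_pos, le_rfl⟩ (le_iSup_of_le j le_rfl))

theorem measurable_history_runningBound (n : ℕ) :
    Measurable[history x M n] fun ω => runningBound (fun k => x k ω) n := by
  have hnorm : ∀ n, Measurable[history x M n] fun ω => max 1 ‖x n ω‖ := fun n => by
    let _ := history x M n
    exact measurable_const.max (measurable_history_state le_rfl).norm
  induction n with
  | zero => simpa only [runningBound, partialSups_zero] using hnorm 0
  | succ n ih =>
    simp only [runningBound, partialSups_add_one]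
    exact (ih.mono (history_mono n.le_succ) le_rfl).max (hnorm (n + 1))

end Noise

section NoiseMoments

variable {N : ℕ} {d : Fin N → ℕ}

theorem one_add_sum_norm_sq_le (x : ℕ → NState d) (n : ℕ) :
    1 + ∑ k, ‖x n k‖ ^ 2 ≤ (1 + N) * runningBound x n ^ 2 := by
  have hone : 1 ≤ runningBound x n ^ 2 := one_le_pow₀ (one_le_runningBound n)
  have hsum : ∑ k, ‖x n k‖ ^ 2 ≤ ∑ _k : Fin N, runningBound x n ^ 2 := by
    gcongr with k
    exact (norm_le_pi_norm (x n) k).trans (norm_le_runningBound n)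
  simp only [Finset.sum_const, Finset.card_univ, Fintype.card_fin, nsmul_eq_mul] at hsum
  linarith

variable {Ω : Type*} {x M : ℕ → Ω → NState d}

/-- The `n`-th noise increment `M⁽ʲ⁾_{n+1}` divided by the running maximum of the iterates up to
time `n`. The quotient has second moments bounded uniformly in `n`. -/
noncomputable def normalizedNoise (x M : ℕ → Ω → NState d) (j : Fin N) (n : ℕ) (ω : Ω) :
    EuclideanSpace ℝ (Fin (d j)) :=
  (runningBound (fun k => x k ω) n)⁻¹ • M (n + 1) ω j

theorem stronglyMeasurable_history_normalizedNoise (j : Fin N) (n : ℕ) :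
    StronglyMeasurable[history x M (n + 1)] (normalizedNoise x M j n) :=
  (((measurable_history_runningBound n).inv.mono (history_mono n.le_succ) le_rfl).smul
    (measurable_history_noise n j)).stronglyMeasurable

variable [m₀ : MeasurableSpace Ω] {μ : Measure Ω} {K : Fin N → ℝ}

theorem IsMartingaleNoise.history_le (hM : IsMartingaleNoise μ x M K)
    (hx : ∀ n j, Measurable fun ω => x n ω j) (n : ℕ) : history x M n ≤ m₀ := by
  refine sup_le (iSup_le fun i => iSup_le fun _ => iSup_le fun j => (hx i j).comap_le)
    (iSup_le fun i => iSup_le fun hi => iSup_le fun j => ?_)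
  obtain ⟨k, rfl⟩ := Nat.exists_eq_add_of_le' hi.1
  exact (hM.measurable k j).comap_le

theorem IsMartingaleNoise.integrable_normalizedNoise (hM : IsMartingaleNoise μ x M K)
    (hx : ∀ n j, Measurable fun ω => x n ω j) (j : Fin N) (n : ℕ) :
    Integrable (normalizedNoise x M j n) μ :=
  (hM.integrable n j).bdd_smul 1
    ((measurable_history_runningBound n).inv.mono (hM.history_le hx n) le_rfl).aestronglyMeasurable
    (Eventually.of_forall fun ω => by
      rw [Pi.inv_apply, norm_inv, Real.norm_of_nonneg (runningBound_pos n).le]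
      exact inv_le_one_of_one_le₀ (one_le_runningBound n))

theorem IsMartingaleNoise.condExp_normalizedNoise (hM : IsMartingaleNoise μ x M K)
    (hx : ∀ n j, Measurable fun ω => x n ω j) (j : Fin N) (n : ℕ) :
    μ[normalizedNoise x M j n | history x M n] =ᵐ[μ] 0 := by
  have hR := (measurable_history_runningBound (x := x) (M := M) n).inv.stronglyMeasurable
  filter_upwards [condExp_smul_of_aestronglyMeasurable_left hR.aestronglyMeasurable
    (hM.integrable_normalizedNoise hx j n) (hM.integrable n j), hM.condExp_eq_zero n j]
    with ω hpull hω
  exact hpull.trans (by simp [hω])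

variable [IsFiniteMeasure μ]

theorem IsMartingaleNoise.lintegral_enorm_normalizedNoise_sq_le (hM : IsMartingaleNoise μ x M K)
    (hx : ∀ n j, Measurable fun ω => x n ω j) (j : Fin N) (n : ℕ) :
    ∫⁻ ω, ‖normalizedNoise x M j n ω‖ₑ ^ 2 ∂μ ≤ ENNReal.ofReal (K j * (1 + N)) * μ Set.univ := by
  have hw : Measurable[history x M n] fun ω => ‖(runningBound (fun k => x k ω) n)⁻¹‖ₑ ^ 2 := by
    let _ := history x M n
    exact (measurable_history_runningBound n).inv.enorm.pow_const 2
  simp only [normalizedNoise, enorm_smul, mul_pow]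
  rw [← lintegral_mul_condLExp (hM.history_le hx n) hw ((hM.measurable n j).enorm.pow_const 2),
    ← lintegral_const]
  refine lintegral_mono_ae ?_
  filter_upwards [hM.condLExp_le n j] with ω hω
  refine (mul_le_mul_right hω _).trans ?_
  set r := runningBound (fun k => x k ω) n
  have hr : 0 < r := runningBound_pos n
  have hK := (hM.const_pos j).le
  rw [Real.enorm_of_nonneg (by positivity), ← ENNReal.ofReal_pow (by positivity),
    ← ENNReal.ofReal_mul (by positivity)]
  refine ENNReal.ofReal_le_ofReal ?_
  calc r⁻¹ ^ 2 * (K j * (1 + ∑ k, ‖x n ω k‖ ^ 2))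
      ≤ r⁻¹ ^ 2 * (K j * ((1 + N) * r ^ 2)) := by
        gcongr
        exact one_add_sum_norm_sq_le (fun k => x k ω) n
    _ = K j * (1 + N) := by field_simp

theorem IsMartingaleNoise.memLp_normalizedNoise (hM : IsMartingaleNoise μ x M K)
    (hx : ∀ n j, Measurable fun ω => x n ω j) (j : Fin N) (n : ℕ) :
    MemLp (normalizedNoise x M j n) 2 μ := by
  have hmeas := (hM.integrable_normalizedNoise hx j n).aestronglyMeasurable
  refine (memLp_two_iff_integrable_sq_norm hmeas).2 ⟨hmeas.norm.pow 2, ?_⟩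
  simp only [HasFiniteIntegral, enorm_pow, enorm_norm]
  exact (hM.lintegral_enorm_normalizedNoise_sq_le hx j n).trans_lt
    (ENNReal.mul_lt_top ENNReal.ofReal_lt_top (measure_lt_top μ _))

theorem IsMartingaleNoise.integral_norm_normalizedNoise_sq_le (hM : IsMartingaleNoise μ x M K)
    (hx : ∀ n j, Measurable fun ω => x n ω j) (j : Fin N) (n : ℕ) :
    ∫ ω, ‖normalizedNoise x M j n ω‖ ^ 2 ∂μ ≤ K j * (1 + N) * μ.real Set.univ := by
  have hK := (hM.const_pos j).le
  have hmeas := (hM.integrable_normalizedNoise hx j n).aestronglyMeasurable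
  rw [integral_eq_lintegral_of_nonneg_ae (Eventually.of_forall fun ω => by positivity)
    (hmeas.norm.fun_pow 2)]
  simp only [ENNReal.ofReal_pow (norm_nonneg _), ofReal_norm]
  refine ENNReal.toReal_le_of_le_ofReal (by positivity) ?_
  rw [ENNReal.ofReal_mul (by positivity), ofReal_measureReal]
  exact hM.lintegral_enorm_normalizedNoise_sq_le hx j n

theorem IsMartingaleNoise.ae_exists_tendsto_sum (hM : IsMartingaleNoise μ x M K)
    (hx : ∀ n j, Measurable fun ω => x n ω j) {a : ℕ → ℝ} (ha : Summable fun n => a n ^ 2)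
    (j : Fin N) :
    ∀ᵐ ω ∂μ, ∃ l, Tendsto (fun n => ∑ k ∈ Finset.range n, a k • normalizedNoise x M j k ω)
      atTop (𝓝 l) := by
  refine ae_exists_tendsto_sum_of_condExp_eq_zero (ξ := fun n => a n • normalizedNoise x M j n)
    (ℱ := ⟨history x M, history_mono, hM.history_le hx⟩)
    (fun n => (stronglyMeasurable_history_normalizedNoise j n).const_smul (a n))
    (fun n => (hM.memLp_normalizedNoise hx j n).const_smul (a n)) (fun n => ?_)
    ((ha.mul_right (K j * (1 + N) * μ.real Set.univ)).of_nonneg_of_le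
      (fun n => by positivity) fun n => ?_)
  · filter_upwards [condExp_smul (μ := μ) (a n) (normalizedNoise x M j n) (history x M n),
      hM.condExp_normalizedNoise hx j n] with ω hpull hω
    exact hpull.trans (by simp [hω])
  · simp only [Pi.smul_apply, norm_smul, mul_pow, Real.norm_eq_abs, sq_abs, integral_const_mul]
    exact mul_le_mul_of_nonneg_left (hM.integral_norm_normalizedNoise_sq_le hx j n) (sq_nonneg _)

theorem IsMartingaleNoise.ae_isAsymptoticEuler
    {h : (j : Fin N) → NState d → EuclideanSpace ℝ (Fin (d j))} {α : Fin N → ℕ → ℝ}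
    (hM : IsMartingaleNoise μ x M K) (hα : ∀ j, Summable fun n => α j n ^ 2)
    (hx : ∀ n j, Measurable fun ω => x n ω j)
    (hrec : ∀ n ω j, x (n + 1) ω j = x n ω j + α j n • (h j (x n ω) + M (n + 1) ω j)) :
    ∀ᵐ ω ∂μ, IsAsymptoticEuler h α fun n => x n ω := by
  filter_upwards [ae_all_iff.2 fun j => hM.ae_exists_tendsto_sum hx (hα j) j] with ω hω
  exact isAsymptoticEuler_of_tendsto_sum (fun n => hrec n ω) hω

end NoiseMoments

theorem theorem3_general {N : ℕ} {d : Fin N → ℕ} {Ω : Type*} [MeasurableSpace Ω]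
    {μ : Measure Ω} [IsFiniteMeasure μ]
    {h : (j : Fin N) → NState d → EuclideanSpace ℝ (Fin (d j))}
    {α : Fin N → ℕ → ℝ} {x M : ℕ → Ω → NState d} {K : Fin N → ℝ}
    {hInf : (i : Fin N) → NFrom d i → EuclideanSpace ℝ (Fin (d i))}
    {lamInf : (i : Fin N) → NAbove d i → EuclideanSpace ℝ (Fin (d i))}
    (hx : ∀ n j, Measurable fun ω => x n ω j)
    (hrec : ∀ n ω j, x (n + 1) ω j = x n ω j + α j n • (h j (x n ω) + M (n + 1) ω j))
    (hh : ∀ j, ∃ L : ℝ≥0, LipschitzWith L (h j)) (hM : IsMartingaleNoise μ x M K)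
    (hα : IsStepSizes α) (hB : ∀ i, ScaledCondition h hInf lamInf i) :
    ∀ᵐ ω ∂μ, BddAbove (Set.range fun n => ∑ j, ‖x n ω j‖) := by
  filter_upwards [hM.ae_isAsymptoticEuler hα.summable_sq_apply hx hrec] with ω hω
  obtain ⟨C, hC⟩ := hω.bddAbove_norm hα hh hB
  refine ⟨∑ _j : Fin N, C, ?_⟩
  rintro _ ⟨n, rfl⟩
  exact Finset.sum_le_sum fun j _ => (norm_le_pi_norm (x n ω) j).trans (hC ⟨n, rfl⟩)

theorem theorem3 {N : ℕ} {d : Fin N → ℕ} {Ω : Type*} [MeasurableSpace Ω]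
    (μ : Measure Ω) [IsProbabilityMeasure μ]
    (h : (j : Fin N) → NState d → EuclideanSpace ℝ (Fin (d j)))
    (α : Fin N → ℕ → ℝ) (x M : ℕ → Ω → NState d) (K : Fin N → ℝ)
    (hInf : (i : Fin N) → NFrom d i → EuclideanSpace ℝ (Fin (d i)))
    (lamInf lam : (i : Fin N) → NAbove d i → EuclideanSpace ℝ (Fin (d i)))
    (hx : ∀ n j, Measurable (fun ω => x n ω j))
    (hrec : ∀ n ω j, x (n + 1) ω j = x n ω j + α j n • (h j (x n ω) + M (n + 1) ω j))
    (hA1 : ∀ j, ∃ L : ℝ≥0, LipschitzWith L (h j))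
    (hA2 : IsMartingaleNoise μ x M K)
    (hA3 : IsStepSizes α)
    (hB : ∀ i, ScaledCondition h hInf lamInf i)
    (hC : ∀ i, LimitCondition h lam i) :
    ∀ᵐ ω ∂μ, BddAbove (Set.range fun n => ∑ j, ‖x n ω j‖) := by
  exact theorem3_general hx hrec hA1 hA2 hA3 hB
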